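/- \textbf{Setting.} Let $a,b,c,\sigma$ be measurable functions on $[0,\infty)$ with values in $M_{d_1}(\mathbb R)$, $M_{d_1,m_1}(\mathbb R)$, $M_{d_2,d_1}(\mathbb R)$, $M_{d_2,m_2}(\mathbb R)$ such that $\int_0^T |a|\,dr$, $\int_0^T |b|^2\,dr$, $\int_0^T |c|^2\,dr$, $\int_0^T|\sigma|^2\,dr$ are finite for every $T\ge 0$, and such that for some constant $C>0$ the smallest eigenvalue of $\sigma(r)\sigma(r)^\top$ exceeds $C$ for every $r\ge 0$. (These are the coefficients of the linear filtering model $dX=aX\,dt+b\,dV$, $dY=cX\,dt+\sigma\,dW$.) Let $X_0$ be a normally distributed random vector in $\mathbb R^{d_1}$ on a probability space $(\Omega,\mathcal F,P)$, with covariance matrix $V[X_0]$, let $\tilde V$ be an $m_1$-dimensional Brownian motion on the same space, and let $t\ge 0$. Let $\phi(\cdot\,;t)$ be the negative semidefinite symmetric solution on $[0,t]$ of $$\frac{d\phi}{ds}(s;t)=-\phi\, b b^\top\phi-a^\top\phi-\phi\, a+c^\top(\sigma\sigma^\top)^{-1}c,\qquad \phi(t;t)=0,$$ and let $\gamma$ be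 the positive semidefinite solution on $[0,t]$ of $$\frac{d\gamma}{dr}=-\gamma c^\top(\sigma\sigma^\top)^{-1}c\,\gamma+a\gamma+\gamma a^\top+bb^\top,\qquad \gamma(0)=V[X_0]$$ (both equations understood in integrated form). Let $\{\xi_{s;t}\}_{0\le s\le t}$ be the continuous solution of $$d_s\xi_{s;t}=\{a(s)+b(s)b(s)^\top\phi(s;t)\}\,\xi_{s;t}\,ds+b(s)\,d\tilde V_s ,$$ where $\xi_{0;t}$ is a normal random vector, independent of $\tilde V$, with mean $0$ and covariance matrix $$V[\xi_{0;t}]=V[X_0]^{1/2}\bigl(I-V[X_0]^{1/2}\phi(0;t)V[X_0]^{1/2}\bigr)^{-1}V[X_0]^{1/2}.$$ Write $\mathrm{Cov}(X,Y)=E[(X-E[X])(Y-E[Y])^\top]$ and $V[X]=\mathrm{Cov}(X,X)$. For an integrable matrix-valued function $A$ and $u\le s$, $\exp\left(\int_u^s A(r)\,dr\right)$ denotes the time-ordered exponential, that is, the state-transition matrix $E(s,u)$ of $x'=A x$, given by $\partial_sE(s,u)=A(s)E(s,u)$, $E(u,u)=I$, or equivalently by the Peano--Baker series $\sum_{n\ge0}I_n(s)$,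 $I_0=I$, $I_{n+1}(s)=\int_u^sA(r)I_n(r)\,dr$. (It is the ordinary matrix exponential of the integral when the matrices $A(r)$ commute with each other.) \textbf{Proposition.} Let $0\le u\le s\le t$. If $\gamma(r)$ is nonsingular for every $r\in[0,t]$, then all $\xi_{r;t}$, $r\in[0,t]$, are square integrable and $$\mathrm{Cov}(\xi_{s;t},\xi_{u;t})=V[\xi_{s;t}]\,\exp\left(-\int_u^s\left\{a(r)^\top+\gamma(r)^{-1}b(r)b(r)^\top\right\}dr\right).$$ -/

import Mathlib

open MeasureTheory ProbabilityTheory Filter Set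
open scoped NNReal ENNReal Topology Matrix MatrixOrder

/-! ### Matrix-valued functions of time -/

/-- The integral `∫_u^s A(r) dr` of a matrix-valued function, taken entry by entry. -/
noncomputable def matrixIntegral {p q : ℕ} (A : ℝ → Matrix (Fin p) (Fin q) ℝ) (u s : ℝ) :
    Matrix (Fin p) (Fin q) ℝ :=
  Matrix.of fun i j => ∫ r in u..s, A r i j

/-- The iterated integrals of the Peano-Baker series of `A` started at time `u`:
`I₀(s) = 1` and `Iₙ₊₁(s) = ∫_u^s A(r) Iₙ(r) dr`. -/
noncomputable def peanoBaker {d : ℕ} (A : ℝ → Matrix (Fin d) (Fin d) ℝ) (u : ℝ) :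
    ℕ → ℝ → Matrix (Fin d) (Fin d) ℝ
  | 0 => fun _ => 1
  | n + 1 => fun s => matrixIntegral (fun r => A r * peanoBaker A u n r) u s

/-- The (time-ordered) exponential `exp (∫_u^s A(r) dr)` of a matrix-valued function, i.e. the
state-transition matrix `E(s, u)` of the linear equation `x'(s) = A(s) x(s)`: `∂ₛE(s, u) = A(s) E(s, u)`,
`E(u, u) = 1`. It is the sum of the Peano-Baker series. When the matrices `A(r)` commute with each
other, the `n`-th term is `(∫_u^s A(r) dr)ⁿ / n!`, and the sum is the matrix exponential of the
integral. -/
noncomputable def orderedExp {d : ℕ} (A : ℝ → Matrix (Fin d) (Fin d) ℝ) (u s : ℝ) :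
    Matrix (Fin d) (Fin d) ℝ :=
  ∑' n : ℕ, peanoBaker A u n s

/-- The covariance matrix `Cov(X, Y) = E[(X - E[X]) (Y - E[Y])ᵀ]` of two random vectors;
`V[X] = Cov(X, X)`. -/
noncomputable def covMatrix {Ω : Type*} [MeasurableSpace Ω] (P : Measure Ω) {p q : ℕ}
    (X : Ω → Fin p → ℝ) (Y : Ω → Fin q → ℝ) : Matrix (Fin p) (Fin q) ℝ :=
  Matrix.of fun i j => covariance (fun ω => X ω i) (fun ω => Y ω j) P

/-! ### The coefficients of the linear system -/

/-- The standing assumptions on the coefficients of the linear system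
`dX = a X dt + b dV`, `dY = c X dt + σ dW` on `[0, ∞)`: they are measurable, `a` is locally
integrable, `b`, `c`, `σ` are locally square integrable (a matrix function has integrable Frobenius
norm, resp. squared Frobenius norm, iff its entries, resp. the squares of its entries, are
integrable), and the smallest eigenvalue of `σ(r) σ(r)ᵀ` stays above a positive constant. -/
structure LinearCoefficients {d₁ d₂ m₁ m₂ : ℕ}
    (a : ℝ → Matrix (Fin d₁) (Fin d₁) ℝ) (b : ℝ → Matrix (Fin d₁) (Fin m₁) ℝ)
    (c : ℝ → Matrix (Fin d₂) (Fin d₁) ℝ) (σ : ℝ → Matrix (Fin d₂) (Fin m₂) ℝ) : Prop where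
  measurable_a : ∀ i j, Measurable fun r => a r i j
  measurable_b : ∀ i j, Measurable fun r => b r i j
  measurable_c : ∀ i j, Measurable fun r => c r i j
  measurable_σ : ∀ i j, Measurable fun r => σ r i j
  integrable_a : ∀ T, 0 ≤ T → ∀ i j, IntervalIntegrable (fun r => a r i j) volume 0 T
  integrable_b : ∀ T, 0 ≤ T → ∀ i j, IntervalIntegrable (fun r => b r i j ^ 2) volume 0 T
  integrable_c : ∀ T, 0 ≤ T → ∀ i j, IntervalIntegrable (fun r => c r i j ^ 2) volume 0 T
  integrable_σ : ∀ T, 0 ≤ T → ∀ i j, IntervalIntegrable (fun r => σ r i j ^ 2) volume 0 T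
  nondegenerate : ∃ C : ℝ, 0 < C ∧ ∀ r, 0 ≤ r → ∀ l : ℝ,
    Module.End.HasEigenvalue (Matrix.toLin' (σ r * (σ r)ᵀ)) l → C < l

/-- `φ = φ(·; t)` is a negative semidefinite symmetric solution on `[0, t]` of the Riccati equation
`dφ/ds = -φ b bᵀ φ - aᵀ φ - φ a + cᵀ (σ σᵀ)⁻¹ c` with `φ(t) = 0`. As the coefficients are only
measurable and integrable, the equation is understood in integrated form. -/
structure IsBackwardRiccatiSolution {d₁ d₂ m₁ m₂ : ℕ}
    (a : ℝ → Matrix (Fin d₁) (Fin d₁) ℝ) (b : ℝ → Matrix (Fin d₁) (Fin m₁) ℝ)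
    (c : ℝ → Matrix (Fin d₂) (Fin d₁) ℝ) (σ : ℝ → Matrix (Fin d₂) (Fin m₂) ℝ)
    (t : ℝ) (φ : ℝ → Matrix (Fin d₁) (Fin d₁) ℝ) : Prop where
  continuousOn : ContinuousOn φ (Icc 0 t)
  negSemidef : ∀ s ∈ Icc 0 t, (-φ s).PosSemidef
  equation : ∀ s ∈ Icc 0 t, φ s = -matrixIntegral (fun r =>
    -(φ r * b r * (b r)ᵀ * φ r) - (a r)ᵀ * φ r - φ r * a r
      + (c r)ᵀ * (σ r * (σ r)ᵀ)⁻¹ * c r) s t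

/-- `γ` is a positive semidefinite solution on `[0, t]` of the Riccati equation
`dγ/dr = -γ cᵀ (σ σᵀ)⁻¹ c γ + a γ + γ aᵀ + b bᵀ` with `γ(0) = S`, in integrated form. -/
structure IsForwardRiccatiSolution {d₁ d₂ m₁ m₂ : ℕ}
    (a : ℝ → Matrix (Fin d₁) (Fin d₁) ℝ) (b : ℝ → Matrix (Fin d₁) (Fin m₁) ℝ)
    (c : ℝ → Matrix (Fin d₂) (Fin d₁) ℝ) (σ : ℝ → Matrix (Fin d₂) (Fin m₂) ℝ)
    (S : Matrix (Fin d₁) (Fin d₁) ℝ)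
    (t : ℝ) (γ : ℝ → Matrix (Fin d₁) (Fin d₁) ℝ) : Prop where
  continuousOn : ContinuousOn γ (Icc 0 t)
  posSemidef : ∀ s ∈ Icc 0 t, (γ s).PosSemidef
  equation : ∀ s ∈ Icc 0 t, γ s = S + matrixIntegral (fun r =>
    -(γ r * (c r)ᵀ * (σ r * (σ r)ᵀ)⁻¹ * c r * γ r) + a r * γ r + γ r * (a r)ᵀ
      + b r * (b r)ᵀ) 0 s

/-! ### Brownian motion, Wiener integrals, linear stochastic differential equations -/

/-- An `m`-dimensional (standard) Brownian motion, given by its components `V k`: the components are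
independent real Brownian motions. -/
structure IsBrownianVector {Ω : Type*} [MeasurableSpace Ω] (P : Measure Ω) {m : ℕ}
    (V : Fin m → ℝ≥0 → Ω → ℝ) : Prop where
  measurable : ∀ k r, Measurable (V k r)
  isBrownian : ∀ k, IsBrownianReal (V k) P
  indep : iIndepFun (fun k ω r => V k r ω) P

/-- A step function `∑_{k < n} c k 1_{(τ k, τ (k + 1)]}` on `(0, s]`. -/
structure StepFunction (s : ℝ≥0) where
  n : ℕ
  τ : ℕ → ℝ≥0
  c : ℕ → ℝ
  mono : Monotone τ
  le : ∀ k, τ k ≤ s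

namespace StepFunction

/-- The value of a step function at time `r`. -/
noncomputable def eval {s : ℝ≥0} (g : StepFunction s) (r : ℝ) : ℝ :=
  ∑ k ∈ Finset.range g.n,
    (Ioc (g.τ k : ℝ) (g.τ (k + 1) : ℝ)).indicator (fun _ => g.c k) r

/-- The elementary stochastic integral of a step function against the process `B`. -/
noncomputable def integral {s : ℝ≥0} (g : StepFunction s) {Ω : Type*} (B : ℝ≥0 → Ω → ℝ)
    (ω : Ω) : ℝ :=
  ∑ k ∈ Finset.range g.n, g.c k * (B (g.τ (k + 1)) ω - B (g.τ k) ω)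

end StepFunction

/-- `J` is (a version of) the stochastic integral `∫_0^s f(r) dB_r` of the deterministic function `f`
against the real Brownian motion `B`: the `L²(P)`-limit of the elementary integrals of step
functions that converge to `f` in `L²(0, s)`. -/
def IsWienerIntegral {Ω : Type*} [MeasurableSpace Ω] (P : Measure Ω) (B : ℝ≥0 → Ω → ℝ)
    (f : ℝ → ℝ) (s : ℝ≥0) (J : Ω → ℝ) : Prop :=
  MemLp J 2 P ∧ ∃ g : ℕ → StepFunction s,
    Tendsto (fun n => eLpNorm (fun r => f r - (g n).eval r) 2 (volume.restrict (Ioc 0 (s : ℝ))))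
      atTop (𝓝 0) ∧
    Tendsto (fun n => eLpNorm (fun ω => J ω - (g n).integral B ω) 2 P) atTop (𝓝 0)

/-- `ξ` is a solution on `[0, t]`, with almost surely continuous paths, of the linear stochastic
differential equation `dξ_s = A(s) ξ_s ds + b(s) dV_s`, i.e. for every `s`, almost surely,
`ξ_s = ξ_0 + ∫_0^s A(r) ξ_r dr + ∫_0^s b(r) dV_r`, whose last term has the components
`∑ₖ ∫_0^s b_{ik}(r) dV^k_r`. -/
structure IsLinearSDESolution {Ω : Type*} [MeasurableSpace Ω] (P : Measure Ω) {d m : ℕ}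
    (A : ℝ → Matrix (Fin d) (Fin d) ℝ) (b : ℝ → Matrix (Fin d) (Fin m) ℝ)
    (V : Fin m → ℝ≥0 → Ω → ℝ) (t : ℝ) (ξ : ℝ → Ω → Fin d → ℝ) : Prop where
  measurable : ∀ s ∈ Icc 0 t, Measurable (ξ s)
  continuous_paths : ∀ᵐ ω ∂P, ContinuousOn (fun s => ξ s ω) (Icc 0 t)
  equation : ∀ s : ℝ≥0, (s : ℝ) ≤ t → ∀ i, ∃ J : Fin m → Ω → ℝ,
    (∀ k, IsWienerIntegral P (V k) (fun r => b r i k) s (J k)) ∧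
    ∀ᵐ ω ∂P, ξ s ω i = ξ 0 ω i + (∫ r in (0 : ℝ)..s, (A r *ᵥ ξ r ω) i) + ∑ k, J k ω

/-- `ξ = ξ_{·;t}` is the process attached to the horizon `t`, the Riccati solution `φ = φ(·; t)` and
the covariance matrix `S = V[X₀]`: it solves `dξ_s = (a + b bᵀ φ) ξ_s ds + b dV_s` on `[0, t]`, and
`ξ_0` is normal, independent of `V`, with mean zero and covariance matrix
`S^{1/2} (1 - S^{1/2} φ(0; t) S^{1/2})⁻¹ S^{1/2}`. -/
structure IsSmoothingProcess {Ω : Type*} [MeasurableSpace Ω] (P : Measure Ω) {d₁ m₁ : ℕ}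
    (a : ℝ → Matrix (Fin d₁) (Fin d₁) ℝ) (b : ℝ → Matrix (Fin d₁) (Fin m₁) ℝ)
    (φ : ℝ → Matrix (Fin d₁) (Fin d₁) ℝ) (S : Matrix (Fin d₁) (Fin d₁) ℝ)
    (V : Fin m₁ → ℝ≥0 → Ω → ℝ) (t : ℝ) (ξ : ℝ → Ω → Fin d₁ → ℝ) : Prop where
  solution : IsLinearSDESolution P (fun r => a r + b r * (b r)ᵀ * φ r) b V t ξ
  gaussian_init : HasGaussianLaw (ξ 0) P
  indep_init : IndepFun (ξ 0) (fun ω k r => V k r ω) P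
  mean_init : ∀ i, ∫ ω, ξ 0 ω i ∂P = 0
  cov_init : covMatrix P (ξ 0) (ξ 0) =
    CFC.sqrt S * (1 - CFC.sqrt S * φ 0 * CFC.sqrt S)⁻¹ * CFC.sqrt S

/-!
Write `A = a + b bᵀ φ`, `β = b bᵀ`, `κ = cᵀ (σ σᵀ)⁻¹ c`. All differential equations have merely
integrable coefficients, so derivatives are taken in the integrated sense of `IsMatrixPrimitiveOn`,
for which sums, transposes and products (`IsMatrixPrimitiveOn.mul`) obey the usual rules.

Two facts about linear equations are needed: the Peano-Baker series solves `E' = A E`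
(`isMatrixPrimitiveOn_orderedExp`), and an equation `X' = L X + X R` with zero initial value has
only the zero solution (`IsMatrixPrimitiveOn.eq_zero`). In particular there are a fundamental matrix
`Φ` of `x' = A x` and its inverse `Ψ` (`exists_fundamentalMatrix`).

The process is solved path by path. With `Z_s = ξ_s - ∫_0^s A ξ dr`, which is `ξ_0 + ∫_0^s b dV`
almost surely, one has `ξ = Φ ∫ Ψ dZ`, the last integral being defined by partial integration
(`partialIntegral_sub_integral`). The Itô isometry for Wiener integrals
(`IsWienerIntegral.covariance_eq`) gives the covariances of `Z`, and Fubini's theorem transfers them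
to `∫ Ψ dZ`. The result (`IsLinearSDESolution.memLp_and_covMatrix_eq`) is that `ξ` is square
integrable with `Cov(ξ_s, ξ_u) = Φ(s) (V[ξ_0] + ∫_0^u Ψ β Ψᵀ) Φ(u)ᵀ` for `u ≤ s`. Consequently
`V[ξ]` solves the Lyapunov equation `V' = A V + V Aᵀ + β`, and `s ↦ Cov(ξ_s, ξ_u)` solves `N' = A N`.

The Riccati equations enter through the identity `V[ξ] = (γ⁻¹ - φ)⁻¹`, in the form
`V (1 - φ γ) = γ`. It holds at time `0` by the choice of `V[ξ_0]` (`sqrt_mul_inv_mul_sqrt_mul`), and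
the defect `Q = V (1 - φ γ) - γ` satisfies `Q' = A Q + Q (aᵀ - κ γ)`, hence vanishes
(`lyapunov_mul_one_sub_eq`). The identity gives `V γ⁻¹ = 1 + V φ`, with which the product `V E` of
`V` and the time-ordered exponential `E` of `-(aᵀ + γ⁻¹ β)` is seen to solve `(V E)' = A V E`, the
equation of `Cov(ξ_s, ξ_u)`, with the same value at `s = u` (`eq_lyapunov_mul_orderedExp`).
-/

/-! ### Primitives in integrated form -/

/-- `F` is on `[u, t]` a primitive of the integrable function `f`. This is how the equation
`F' = f` is understood throughout: in integrated form, `F` being absolutely continuous. -/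
def IsPrimitiveOn (F f : ℝ → ℝ) (u t : ℝ) : Prop :=
  u ≤ t ∧ IntervalIntegrable f volume u t ∧ ∀ s ∈ Icc u t, F s = F u + ∫ r in u..s, f r

lemma IntervalIntegrable.mono_Icc {f : ℝ → ℝ} {u t v w : ℝ} (hf : IntervalIntegrable f volume u t)
    (hv : v ∈ Icc u t) (hw : w ∈ Icc u t) : IntervalIntegrable f volume v w := by
  refine hf.mono_set ?_
  rw [uIcc_of_le (hv.1.trans hv.2)]
  exact uIcc_subset_Icc hv hw

namespace IsPrimitiveOn

variable {F f G g : ℝ → ℝ} {u t : ℝ}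

lemma le (h : IsPrimitiveOn F f u t) : u ≤ t := h.1

lemma intervalIntegrable (h : IsPrimitiveOn F f u t) : IntervalIntegrable f volume u t := h.2.1

lemma eq (h : IsPrimitiveOn F f u t) {s : ℝ} (hs : s ∈ Icc u t) : F s = F u + ∫ r in u..s, f r :=
  h.2.2 s hs

lemma continuousOn (h : IsPrimitiveOn F f u t) : ContinuousOn F (Icc u t) := by
  have hf : IntegrableOn f (uIcc u t) := by
    have := (intervalIntegrable_iff_integrableOn_Icc_of_le h.le).1 h.intervalIntegrable
    rwa [uIcc_of_le h.le]
  have := intervalIntegral.continuousOn_primitive_interval hf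
  rw [uIcc_of_le h.le] at this
  exact (continuousOn_const.add this).congr fun s hs => h.eq hs

lemma congr {F' f' : ℝ → ℝ} (h : IsPrimitiveOn F f u t) (hF : ∀ s ∈ Icc u t, F' s = F s)
    (hf : ∀ s ∈ Icc u t, f' s = f s) : IsPrimitiveOn F' f' u t := by
  have key : ∀ s ∈ Icc u t, ∀ r ∈ uIcc u s, f' r = f r := fun s hs r hr => by
    rw [uIcc_of_le hs.1] at hr
    exact hf r ⟨hr.1, hr.2.trans hs.2⟩
  refine ⟨h.le, h.intervalIntegrable.congr fun r hr => ?_, fun s hs => ?_⟩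
  · exact (key t ⟨h.le, le_rfl⟩ r (uIoc_subset_uIcc hr)).symm
  · rw [hF s hs, hF u ⟨le_rfl, h.le⟩, h.eq hs, intervalIntegral.integral_congr (key s hs)]

lemma add (hF : IsPrimitiveOn F f u t) (hG : IsPrimitiveOn G g u t) :
    IsPrimitiveOn (fun s => F s + G s) (fun s => f s + g s) u t := by
  refine ⟨hF.le, hF.2.1.add hG.2.1, fun s hs => ?_⟩
  have hu : u ∈ Icc u t := ⟨le_rfl, hF.le⟩
  simp only [hF.eq hs, hG.eq hs, intervalIntegral.integral_add (hF.2.1.mono_Icc hu hs)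
    (hG.2.1.mono_Icc hu hs)]
  ring

lemma neg (hF : IsPrimitiveOn F f u t) : IsPrimitiveOn (fun s => -F s) (fun s => -f s) u t := by
  refine ⟨hF.le, hF.2.1.neg, fun s hs => ?_⟩
  simp only [intervalIntegral.integral_neg, hF.eq hs]
  ring

lemma const (hut : u ≤ t) (c : ℝ) : IsPrimitiveOn (fun _ => c) (fun _ => 0) u t :=
  ⟨hut, intervalIntegrable_const, fun s _ => by simp⟩

lemma sum (hut : u ≤ t) {ι : Type*} (S : Finset ι) {F f : ι → ℝ → ℝ}
    (h : ∀ i ∈ S, IsPrimitiveOn (F i) (f i) u t) :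
    IsPrimitiveOn (fun s => ∑ i ∈ S, F i s) (fun s => ∑ i ∈ S, f i s) u t := by
  induction S using Finset.cons_induction with
  | empty => simpa using const hut 0
  | cons i S hi ih =>
    simp only [Finset.sum_cons]
    exact (h i (by simp)).add (ih fun j hj => h j (by simp [hj]))

lemma mono {v w : ℝ} (h : IsPrimitiveOn F f u t) (hv : v ∈ Icc u t) (hw : w ∈ Icc u t)
    (hvw : v ≤ w) : IsPrimitiveOn F f v w := by
  have hu : u ∈ Icc u t := ⟨le_rfl, h.le⟩
  refine ⟨hvw, h.2.1.mono_Icc hv hw, fun s hs => ?_⟩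
  have hs' : s ∈ Icc u t := ⟨hv.1.trans hs.1, hs.2.trans hw.2⟩
  rw [h.eq hs', h.eq hv, add_assoc, intervalIntegral.integral_add_adjacent_intervals
    (h.2.1.mono_Icc hu hv) (h.2.1.mono_Icc hv hs')]

/-- The product rule, by the fundamental theorem of calculus for absolutely continuous functions. -/
lemma mul (hF : IsPrimitiveOn F f u t) (hG : IsPrimitiveOn G g u t) :
    IsPrimitiveOn (fun s => F s * G s) (fun s => f s * G s + F s * g s) u t := by
  have hut := hF.le
  have hFc : ContinuousOn F (uIcc u t) := by rw [uIcc_of_le hut]; exact hF.continuousOn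
  have hGc : ContinuousOn G (uIcc u t) := by rw [uIcc_of_le hut]; exact hG.continuousOn
  refine ⟨hut, (hF.2.1.mul_continuousOn hGc).add (hG.2.1.continuousOn_mul hFc), fun s hs => ?_⟩
  have hs' : uIcc u s ⊆ Icc u t := by
    rw [uIcc_of_le hs.1]; exact Icc_subset_Icc_right hs.2
  have hf := hF.2.1.mono_Icc ⟨le_rfl, hut⟩ hs
  have hg := hG.2.1.mono_Icc ⟨le_rfl, hut⟩ hs
  have hac : ∀ {k : ℝ → ℝ} (c : ℝ), IntervalIntegrable k volume u s →
      AbsolutelyContinuousOnInterval (fun x => c + ∫ r in u..x, k r) u s := fun c hk =>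
    (AbsolutelyContinuousOnInterval.add
      (LipschitzOnWith.absolutelyContinuousOnInterval (K := 0)
        ((LipschitzWith.const c).lipschitzOnWith))
      (hk.absolutelyContinuousOnInterval_intervalIntegral left_mem_uIcc))
  have key := AbsolutelyContinuousOnInterval.integral_deriv_mul_eq_sub
    (hac (F u) hf) (hac (G u) hg)
  rw [← hF.eq hs, ← hG.eq hs] at key
  simp only [intervalIntegral.integral_same, add_zero] at key
  rw [← sub_eq_iff_eq_add', ← key]
  refine intervalIntegral.integral_congr_ae ?_
  filter_upwards [hf.ae_hasDerivAt_integral, hg.ae_hasDerivAt_integral] with x hx₁ hx₂ hx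
  have hx' := uIoc_subset_uIcc hx
  rw [((hx₁ hx' u left_mem_uIcc).const_add (F u)).deriv,
    ((hx₂ hx' u left_mem_uIcc).const_add (G u)).deriv, ← hF.eq (hs' hx'), ← hG.eq (hs' hx')]

/-- `∫_u^s k (∫_u^r k)ⁿ dr = (∫_u^s k)ⁿ⁺¹ / (n + 1)`, in integrated form. -/
lemma pow_div_factorial (hF : IsPrimitiveOn F f u t) (n : ℕ) :
    IsPrimitiveOn (fun s => F s ^ (n + 1) / (n + 1).factorial)
      (fun s => f s * (F s ^ n / n.factorial)) u t := by
  induction n with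
  | zero => simpa using hF
  | succ n ih =>
    have h := (ih.mul hF).mul (const hF.le ((n + 2 : ℝ)⁻¹))
    refine h.congr (fun s _ => ?_) (fun s _ => ?_)
    · rw [Nat.factorial_succ (n + 1)]
      push_cast
      have : ((n + 1).factorial : ℝ) ≠ 0 := by positivity
      field_simp
      ring
    · rw [Nat.factorial_succ n]
      push_cast
      have : (n.factorial : ℝ) ≠ 0 := by positivity
      field_simp
      ring

end IsPrimitiveOn

/-- A matrix-valued function all of whose entries are integrable on `[u, t]`. -/
def MatrixIntegrableOn {p q : ℕ} (A : ℝ → Matrix (Fin p) (Fin q) ℝ) (u t : ℝ) : Prop :=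
  ∀ i j, IntervalIntegrable (fun r => A r i j) volume u t

/-- `F` is on `[u, t]` an entrywise primitive of the matrix-valued function `f`. -/
def IsMatrixPrimitiveOn {p q : ℕ} (F f : ℝ → Matrix (Fin p) (Fin q) ℝ) (u t : ℝ) : Prop :=
  ∀ i j, IsPrimitiveOn (fun r => F r i j) (fun r => f r i j) u t

lemma continuousOn_matrix_iff {p q : ℕ} {F : ℝ → Matrix (Fin p) (Fin q) ℝ} {S : Set ℝ} :
    ContinuousOn F S ↔ ∀ i j, ContinuousOn (fun r => F r i j) S :=
  continuousOn_pi.trans (forall_congr' fun _ => continuousOn_pi)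

namespace MatrixIntegrableOn

variable {p q k : ℕ} {u t : ℝ} {A B : ℝ → Matrix (Fin p) (Fin q) ℝ}

lemma add (hA : MatrixIntegrableOn A u t) (hB : MatrixIntegrableOn B u t) :
    MatrixIntegrableOn (fun r => A r + B r) u t := fun i j => (hA i j).add (hB i j)

lemma neg (hA : MatrixIntegrableOn A u t) : MatrixIntegrableOn (fun r => -A r) u t :=
  fun i j => (hA i j).neg

lemma transpose (hA : MatrixIntegrableOn A u t) : MatrixIntegrableOn (fun r => (A r)ᵀ) u t :=
  fun i j => hA j i

lemma mono (hA : MatrixIntegrableOn A u t) {v w : ℝ} (hv : v ∈ Icc u t) (hw : w ∈ Icc u t) :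
    MatrixIntegrableOn A v w := fun i j => (hA i j).mono_Icc hv hw

lemma mul_continuousOn (hut : u ≤ t) (hA : MatrixIntegrableOn A u t)
    {F : ℝ → Matrix (Fin q) (Fin k) ℝ} (hF : ContinuousOn F (Icc u t)) :
    MatrixIntegrableOn (fun r => A r * F r) u t := fun i j => by
  simp only [Matrix.mul_apply]
  have := IntervalIntegrable.sum Finset.univ fun l (_ : l ∈ Finset.univ) =>
    (hA i l).mul_continuousOn (by
      rw [uIcc_of_le hut]; exact continuousOn_matrix_iff.1 hF l j)
  exact this.congr fun r _ => by simp

lemma continuousOn_mul (hut : u ≤ t) (hA : MatrixIntegrableOn A u t)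
    {F : ℝ → Matrix (Fin k) (Fin p) ℝ} (hF : ContinuousOn F (Icc u t)) :
    MatrixIntegrableOn (fun r => F r * A r) u t := fun i j => by
  simp only [Matrix.mul_apply]
  have := IntervalIntegrable.sum Finset.univ fun l (_ : l ∈ Finset.univ) =>
    (hA l j).continuousOn_mul (by
      rw [uIcc_of_le hut]; exact continuousOn_matrix_iff.1 hF i l)
  exact this.congr fun r _ => by simp

end MatrixIntegrableOn

namespace IsMatrixPrimitiveOn

variable {p q k : ℕ} {u t : ℝ} {F f G g : ℝ → Matrix (Fin p) (Fin q) ℝ}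

lemma continuousOn (h : IsMatrixPrimitiveOn F f u t) : ContinuousOn F (Icc u t) :=
  continuousOn_matrix_iff.2 fun i j => (h i j).continuousOn

lemma congr {F' f' : ℝ → Matrix (Fin p) (Fin q) ℝ} (h : IsMatrixPrimitiveOn F f u t)
    (hF : ∀ s ∈ Icc u t, F' s = F s) (hf : ∀ s ∈ Icc u t, f' s = f s) :
    IsMatrixPrimitiveOn F' f' u t := fun i j =>
  (h i j).congr (fun s hs => by rw [hF s hs]) (fun s hs => by rw [hf s hs])

lemma add (hF : IsMatrixPrimitiveOn F f u t) (hG : IsMatrixPrimitiveOn G g u t) :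
    IsMatrixPrimitiveOn (fun s => F s + G s) (fun s => f s + g s) u t :=
  fun i j => (hF i j).add (hG i j)

lemma neg (hF : IsMatrixPrimitiveOn F f u t) :
    IsMatrixPrimitiveOn (fun s => -F s) (fun s => -f s) u t := fun i j => (hF i j).neg

lemma sub (hF : IsMatrixPrimitiveOn F f u t) (hG : IsMatrixPrimitiveOn G g u t) :
    IsMatrixPrimitiveOn (fun s => F s - G s) (fun s => f s - g s) u t := by
  simpa only [sub_eq_add_neg] using hF.add hG.neg

lemma transpose (hF : IsMatrixPrimitiveOn F f u t) :
    IsMatrixPrimitiveOn (fun s => (F s)ᵀ) (fun s => (f s)ᵀ) u t := fun i j => hF j i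

lemma const (hut : u ≤ t) (c : Matrix (Fin p) (Fin q) ℝ) :
    IsMatrixPrimitiveOn (fun _ => c) (fun _ => 0) u t := fun i j => IsPrimitiveOn.const hut (c i j)

lemma mono {v w : ℝ} (h : IsMatrixPrimitiveOn F f u t) (hv : v ∈ Icc u t) (hw : w ∈ Icc u t)
    (hvw : v ≤ w) : IsMatrixPrimitiveOn F f v w := fun i j => (h i j).mono hv hw hvw

lemma mul (hut : u ≤ t) {H h : ℝ → Matrix (Fin q) (Fin k) ℝ} (hF : IsMatrixPrimitiveOn F f u t)
    (hH : IsMatrixPrimitiveOn H h u t) :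
    IsMatrixPrimitiveOn (fun s => F s * H s) (fun s => f s * H s + F s * h s) u t := fun i j => by
  refine (IsPrimitiveOn.sum hut Finset.univ fun l _ => (hF i l).mul (hH l j)).congr
    (fun s _ => Matrix.mul_apply) (fun s _ => ?_)
  change (f s * H s + F s * h s) i j = _
  rw [Matrix.add_apply, Matrix.mul_apply, Matrix.mul_apply, Finset.sum_add_distrib]

lemma of_matrixIntegral (hut : u ≤ t) (hf : MatrixIntegrableOn f u t)
    (c : Matrix (Fin p) (Fin q) ℝ)
    (hF : ∀ s ∈ Icc u t, F s = c + matrixIntegral f u s) : IsMatrixPrimitiveOn F f u t := by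
  have hu : F u = c := by
    rw [hF u ⟨le_rfl, hut⟩]
    ext i j
    simp [matrixIntegral]
  refine fun i j => ⟨hut, hf i j, fun s hs => ?_⟩
  change F s i j = F u i j + _
  rw [hF s hs, hu]
  rfl

end IsMatrixPrimitiveOn

/-! ### Linear differential equations with integrable coefficients -/

/-- The sum of the absolute values of the entries of a matrix. -/
def entryNorm {p q : ℕ} (A : Matrix (Fin p) (Fin q) ℝ) : ℝ := ∑ i, ∑ j, |A i j|

lemma entryNorm_nonneg {p q : ℕ} (A : Matrix (Fin p) (Fin q) ℝ) : 0 ≤ entryNorm A :=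
  Finset.sum_nonneg fun _ _ => Finset.sum_nonneg fun _ _ => abs_nonneg _

lemma abs_mul_apply_le_left {p q k : ℕ} (A : Matrix (Fin p) (Fin q) ℝ)
    (X : Matrix (Fin q) (Fin k) ℝ) {M : ℝ} (hX : ∀ i j, |X i j| ≤ M) (i : Fin p) (j : Fin k) :
    |(A * X) i j| ≤ entryNorm A * M := by
  rw [Matrix.mul_apply]
  calc |∑ l, A i l * X l j| ≤ ∑ l, |A i l| * M := by
        refine (Finset.abs_sum_le_sum_abs _ _).trans (Finset.sum_le_sum fun l _ => ?_)
        rw [abs_mul]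
        exact mul_le_mul_of_nonneg_left (hX l j) (abs_nonneg _)
    _ = (∑ l, |A i l|) * M := by rw [Finset.sum_mul]
    _ ≤ entryNorm A * M := by
        rcases isEmpty_or_nonempty (Fin q) with h | ⟨⟨l⟩⟩
        · simp [entryNorm]
        · refine mul_le_mul_of_nonneg_right ?_ ((abs_nonneg _).trans (hX l j))
          exact Finset.single_le_sum (f := fun i => ∑ l, |A i l|)
            (fun _ _ => Finset.sum_nonneg fun _ _ => abs_nonneg _) (Finset.mem_univ i)

lemma abs_mul_apply_le_right {p q k : ℕ} (X : Matrix (Fin p) (Fin q) ℝ)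
    (A : Matrix (Fin q) (Fin k) ℝ) {M : ℝ} (hX : ∀ i j, |X i j| ≤ M) (i : Fin p) (j : Fin k) :
    |(X * A) i j| ≤ entryNorm A * M := by
  have h := abs_mul_apply_le_left Aᵀ Xᵀ (M := M) (fun i j => hX j i) j i
  rw [← Matrix.transpose_mul, Matrix.transpose_apply] at h
  rwa [entryNorm, Finset.sum_comm]

lemma MatrixIntegrableOn.intervalIntegrable_entryNorm {p q : ℕ} {u t : ℝ}
    {A : ℝ → Matrix (Fin p) (Fin q) ℝ} (hA : MatrixIntegrableOn A u t) :
    IntervalIntegrable (fun r => entryNorm (A r)) volume u t := by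
  have := IntervalIntegrable.sum Finset.univ fun i (_ : i ∈ Finset.univ) =>
    IntervalIntegrable.sum Finset.univ fun j (_ : j ∈ Finset.univ) => (hA i j).abs
  exact this.congr fun r _ => by simp [entryNorm]

/-- One step of the iteration that bounds the solutions of a linear integral equation. -/
lemma IsPrimitiveOn.abs_integral_le_pow_div_factorial {K k : ℝ → ℝ} {u t M : ℝ}
    (hK : IsPrimitiveOn K k u t) (hK0 : K u = 0) {f : ℝ → ℝ} (n : ℕ)
    (hf : ∀ r ∈ Icc u t, |f r| ≤ k r * (M * (K r ^ n / n.factorial))) {s : ℝ} (hs : s ∈ Icc u t) :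
    |∫ r in u..s, f r| ≤ M * (K s ^ (n + 1) / (n + 1).factorial) := by
  have hp : IsPrimitiveOn (fun s => M * (K s ^ (n + 1) / (n + 1).factorial))
      (fun r => k r * (M * (K r ^ n / n.factorial))) u t :=
    ((IsPrimitiveOn.const hK.le M).mul (hK.pow_div_factorial n)).congr (fun _ _ => rfl)
      (fun _ _ => by ring)
  have h := hp.eq hs
  simp only [hK0, ne_eq, Nat.add_eq_zero_iff, one_ne_zero, and_false, not_false_eq_true, zero_pow,
    zero_div, mul_zero, zero_add] at h
  rw [h]
  exact intervalIntegral.norm_integral_le_of_norm_le hs.1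
    (Eventually.of_forall fun r hr => (Real.norm_eq_abs _).trans_le
      (hf r ⟨hr.1.le, hr.2.trans hs.2⟩))
    (hp.intervalIntegrable.mono_Icc ⟨le_rfl, hK.le⟩ hs)

/-- Uniqueness for the linear equation `X' = L X + X R` with integrable coefficients: iterating the
equation bounds the entries of `X` by `M Kⁿ / n!` for every `n`, where `K` is the integral of the
norms of `L` and `R`. -/
theorem IsMatrixPrimitiveOn.eq_zero {p q : ℕ} {u t : ℝ} {X : ℝ → Matrix (Fin p) (Fin q) ℝ}
    {L : ℝ → Matrix (Fin p) (Fin p) ℝ} {R : ℝ → Matrix (Fin q) (Fin q) ℝ} (hut : u ≤ t)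
    (hL : MatrixIntegrableOn L u t) (hR : MatrixIntegrableOn R u t)
    (hX : IsMatrixPrimitiveOn X (fun r => L r * X r + X r * R r) u t) (h0 : X u = 0)
    {s : ℝ} (hs : s ∈ Icc u t) : X s = 0 := by
  set k : ℝ → ℝ := fun r => entryNorm (L r) + entryNorm (R r) with hk
  set K : ℝ → ℝ := fun s => ∫ r in u..s, k r
  have hK : IsPrimitiveOn K k u t :=
    ⟨hut, hL.intervalIntegrable_entryNorm.add hR.intervalIntegrable_entryNorm,
      fun s _ => by simp [K]⟩
  have hK0 : K u = 0 := by simp [K]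
  obtain ⟨M, hM⟩ : ∃ M, ∀ r ∈ Icc u t, ∀ i j, |X r i j| ≤ M := by
    have hc : ContinuousOn (fun r => entryNorm (X r)) (Icc u t) :=
      continuousOn_finsetSum _ fun i _ => continuousOn_finsetSum _ fun j _ =>
        (continuousOn_matrix_iff.1 hX.continuousOn i j).abs
    obtain ⟨M, hM⟩ := isCompact_Icc.exists_bound_of_continuousOn hc
    refine ⟨M, fun r hr i j => le_trans ?_ ((le_abs_self _).trans (hM r hr))⟩
    exact (Finset.single_le_sum (f := fun j => |X r i j|) (fun _ _ => abs_nonneg _)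
      (Finset.mem_univ j)).trans (Finset.single_le_sum (f := fun i => ∑ j, |X r i j|)
        (fun _ _ => Finset.sum_nonneg fun _ _ => abs_nonneg _) (Finset.mem_univ i))
  have key : ∀ n : ℕ, ∀ r ∈ Icc u t, ∀ i j, |X r i j| ≤ M * (K r ^ n / n.factorial) := by
    intro n
    induction n with
    | zero => simpa using hM
    | succ n ih =>
      intro r hr i j
      rw [(hX i j).eq hr, h0, Matrix.zero_apply, zero_add]
      refine hK.abs_integral_le_pow_div_factorial hK0 n (fun r hr => ?_) hr
      rw [hk, add_mul]
      exact (abs_add_le _ _).trans (add_le_add (abs_mul_apply_le_left _ _ (ih r hr) i j)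
        (abs_mul_apply_le_right _ _ (ih r hr) i j))
  ext i j
  have hlim : Tendsto (fun n : ℕ => M * (K s ^ n / n.factorial)) atTop (𝓝 0) := by
    simpa using (FloorSemiring.tendsto_pow_div_factorial_atTop (K s)).const_mul M
  exact abs_nonpos_iff.1 (ge_of_tendsto' hlim fun n => key n s hs i j)

section PeanoBaker

variable {d : ℕ} {A : ℝ → Matrix (Fin d) (Fin d) ℝ} {u t : ℝ}

lemma peanoBaker_bound (hut : u ≤ t) (hA : MatrixIntegrableOn A u t) (n : ℕ) :
    ContinuousOn (peanoBaker A u n) (Icc u t) ∧ ∀ s ∈ Icc u t, ∀ i j,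
      |peanoBaker A u n s i j| ≤ (∫ r in u..s, entryNorm (A r)) ^ n / n.factorial := by
  have hK : IsPrimitiveOn (fun s => ∫ r in u..s, entryNorm (A r)) (fun r => entryNorm (A r)) u t :=
    ⟨hut, hA.intervalIntegrable_entryNorm, fun s _ => by simp⟩
  induction n with
  | zero =>
    refine ⟨continuousOn_const, fun s _ i j => ?_⟩
    rcases eq_or_ne i j with rfl | hij
    · simp [peanoBaker]
    · simp [peanoBaker, hij]
  | succ n ih =>
    constructor
    · refine (IsMatrixPrimitiveOn.of_matrixIntegral hut (hA.mul_continuousOn hut ih.1) 0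
        (fun s _ => ?_)).continuousOn
      rw [zero_add]
      rfl
    · intro s hs i j
      have := hK.abs_integral_le_pow_div_factorial (M := 1) (by simp) n
        (f := fun r => (A r * peanoBaker A u n r) i j) (fun r hr => by
          rw [one_mul]
          exact abs_mul_apply_le_left _ _ (ih.2 r hr) i j) hs
      rwa [one_mul] at this

lemma hasSum_peanoBaker (hut : u ≤ t) (hA : MatrixIntegrableOn A u t) {s : ℝ}
    (hs : s ∈ Icc u t) (i j : Fin d) :
    HasSum (fun n => peanoBaker A u n s i j) (orderedExp A u s i j) := by
  have hsum : ∀ i j, Summable fun n => peanoBaker A u n s i j := fun i j =>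
    Summable.of_norm_bounded (Real.summable_pow_div_factorial _)
      fun n => (peanoBaker_bound hut hA n).2 s hs i j
  have h : HasSum (fun n => peanoBaker A u n s)
      (Matrix.of fun i j => ∑' n, peanoBaker A u n s i j) :=
    Pi.hasSum.2 fun i => Pi.hasSum.2 fun j => (hsum i j).hasSum
  rw [orderedExp, h.tsum_eq]
  exact (hsum i j).hasSum

lemma orderedExp_self (A : ℝ → Matrix (Fin d) (Fin d) ℝ) (u : ℝ) : orderedExp A u u = 1 := by
  rw [orderedExp, tsum_eq_single 0]
  · rfl
  · intro n hn
    obtain ⟨n, rfl⟩ := Nat.exists_eq_succ_of_ne_zero hn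
    ext i j
    simp [peanoBaker, matrixIntegral]

/-- The time-ordered exponential is the solution of `E' = A E`: the Peano-Baker series may be
integrated term by term. -/
theorem isMatrixPrimitiveOn_orderedExp (hut : u ≤ t) (hA : MatrixIntegrableOn A u t) :
    IsMatrixPrimitiveOn (orderedExp A u) (fun r => A r * orderedExp A u r) u t := by
  set k : ℝ → ℝ := fun r => entryNorm (A r) with hk
  have hkint := hA.intervalIntegrable_entryNorm
  have hu : u ∈ Icc u t := ⟨le_rfl, hut⟩
  have hsum : ∀ s ∈ Icc u t, ∀ i j, HasSum (fun n => peanoBaker A u (n + 1) s i j)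
      (∫ r in u..s, (A r * orderedExp A u r) i j) := by
    intro s hs i j
    have hKmono : ∀ r ∈ Icc u s, (∫ x in u..r, k x) ≤ ∫ x in u..s, k x := fun r hr =>
      intervalIntegral.integral_mono_interval le_rfl hr.1 hr.2
        (Eventually.of_forall fun x => entryNorm_nonneg _) (hkint.mono_Icc hu hs)
    refine intervalIntegral.hasSum_integral_of_dominated_convergence
      (fun n r => k r * ((∫ x in u..s, k x) ^ n / n.factorial)) (fun n => ?_) (fun n => ?_) ?_ ?_ ?_
    · exact (IntervalIntegrable.mono_Icc (hA.mul_continuousOn hut (peanoBaker_bound hut hA n).1 i j)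
        hu hs).aestronglyMeasurable_restrict_uIoc
    · refine Eventually.of_forall fun r hr => ?_
      rw [uIoc_of_le hs.1] at hr
      have hr' : r ∈ Icc u t := ⟨hr.1.le, hr.2.trans hs.2⟩
      refine abs_mul_apply_le_left _ _ (fun i j =>
        ((peanoBaker_bound hut hA n).2 r hr' i j).trans ?_) i j
      have h0 : 0 ≤ ∫ x in u..r, k x :=
        intervalIntegral.integral_nonneg hr.1.le fun x _ => entryNorm_nonneg _
      have := hKmono r ⟨hr.1.le, hr.2⟩
      gcongr
    · exact Eventually.of_forall fun r _ => (Real.summable_pow_div_factorial _).mul_left _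
    · simp only [tsum_mul_left]
      exact (hkint.mono_Icc hu hs).mul_const _
    · refine Eventually.of_forall fun r hr => ?_
      rw [uIoc_of_le hs.1] at hr
      simp only [Matrix.mul_apply]
      exact hasSum_sum fun l _ =>
        (hasSum_peanoBaker hut hA ⟨hr.1.le, hr.2.trans hs.2⟩ l j).mul_left _
  have heq : ∀ s ∈ Icc u t, orderedExp A u s
      = 1 + matrixIntegral (fun r => A r * orderedExp A u r) u s := by
    intro s hs
    ext i j
    have h1 := (hasSum_nat_add_iff' 1).2 (hasSum_peanoBaker hut hA hs i j)
    have := h1.unique (hsum s hs i j)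
    simp only [Finset.range_one, Finset.sum_singleton] at this
    rw [Matrix.add_apply]
    exact sub_eq_iff_eq_add'.1 this
  have hcont : ContinuousOn (orderedExp A u) (Icc u t) := by
    refine continuousOn_matrix_iff.2 fun i j => ?_
    have : TendstoUniformlyOn (fun N s => ∑ n ∈ Finset.range N, peanoBaker A u n s i j)
        (fun s => ∑' n, peanoBaker A u n s i j) atTop (Icc u t) := by
      refine tendstoUniformlyOn_tsum_nat (Real.summable_pow_div_factorial (∫ x in u..t, k x))
        fun n s hs => ((peanoBaker_bound hut hA n).2 s hs i j).trans ?_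
      have h0 : 0 ≤ ∫ x in u..s, k x :=
        intervalIntegral.integral_nonneg hs.1 fun x _ => entryNorm_nonneg _
      have : ∫ x in u..s, k x ≤ ∫ x in u..t, k x :=
        intervalIntegral.integral_mono_interval le_rfl hs.1 hs.2
          (Eventually.of_forall fun x => entryNorm_nonneg _) hkint
      gcongr
    refine (this.continuousOn (Frequently.of_forall fun N => continuousOn_finsetSum _ fun n _ =>
      continuousOn_matrix_iff.1 (peanoBaker_bound hut hA n).1 i j)).congr fun s hs => ?_
    exact (hasSum_peanoBaker hut hA hs i j).tsum_eq.symm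
  exact IsMatrixPrimitiveOn.of_matrixIntegral hut (hA.mul_continuousOn hut hcont) 1 heq

/-- A fundamental matrix `Φ` of `x' = A x` together with its inverse `Ψ`, which solves
`Ψ' = -Ψ A`: the transpose of `Ψ` is the time-ordered exponential of `-Aᵀ`. -/
theorem exists_fundamentalMatrix (hut : u ≤ t) (hA : MatrixIntegrableOn A u t) :
    ∃ Φ Ψ : ℝ → Matrix (Fin d) (Fin d) ℝ,
      IsMatrixPrimitiveOn Φ (fun r => A r * Φ r) u t ∧
      IsMatrixPrimitiveOn Ψ (fun r => -(Ψ r * A r)) u t ∧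
      Ψ u = 1 ∧ ∀ s ∈ Icc u t, Φ s * Ψ s = 1 := by
  have hΦ := isMatrixPrimitiveOn_orderedExp hut hA
  have hΨ := (isMatrixPrimitiveOn_orderedExp hut hA.transpose.neg).transpose
  have hΨ' : IsMatrixPrimitiveOn (fun s => (orderedExp (fun r => -(A r)ᵀ) u s)ᵀ)
      (fun r => -((orderedExp (fun r => -(A r)ᵀ) u r)ᵀ * A r)) u t :=
    hΨ.congr (fun _ _ => rfl) fun s _ => by simp
  refine ⟨_, _, hΦ, hΨ', ?_, fun s hs => ?_⟩
  · simp [orderedExp_self]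
  · have hX : IsMatrixPrimitiveOn
        (fun s => (orderedExp (fun r => -(A r)ᵀ) u s)ᵀ * orderedExp A u s - 1) (fun _ => 0) u t :=
      ((hΨ'.mul hut hΦ).sub (IsMatrixPrimitiveOn.const hut 1)).congr (fun _ _ => rfl)
        fun s _ => by simp [mul_assoc]
    have h := IsMatrixPrimitiveOn.eq_zero (L := fun _ => 0) (R := fun _ => 0) hut
      (fun _ _ => intervalIntegrable_const) (fun _ _ => intervalIntegrable_const)
      (hX.congr (fun _ _ => rfl) fun s _ => by simp) (by simp [orderedExp_self]) hs
    exact mul_eq_one_comm.1 (sub_eq_zero.1 h)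

end PeanoBaker

/-! ### Integrability of the coefficients of the Riccati equations -/

lemma IntervalIntegrable.mul_of_sq {f g : ℝ → ℝ} {u t : ℝ} (hfm : Measurable f)
    (hgm : Measurable g) (hf : IntervalIntegrable (fun r => f r ^ 2) volume u t)
    (hg : IntervalIntegrable (fun r => g r ^ 2) volume u t) :
    IntervalIntegrable (fun r => f r * g r) volume u t := by
  refine (hf.add hg).mono_fun (hfm.mul hgm).aestronglyMeasurable (Eventually.of_forall fun r => ?_)
  beta_reduce
  rw [Real.norm_eq_abs, Real.norm_eq_abs, abs_le, abs_of_nonneg (by positivity)]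
  constructor <;> nlinarith [sq_nonneg (f r + g r), sq_nonneg (f r - g r)]

/-- If all eigenvalues of `M Mᵀ` exceed `C > 0`, then the entries of `(M Mᵀ)⁻¹` are at most
`C⁻¹`. -/
lemma Matrix.abs_inv_mul_transpose_apply_le {p q : ℕ} (M : Matrix (Fin p) (Fin q) ℝ) {C : ℝ}
    (hC : 0 < C)
    (h : ∀ l : ℝ, Module.End.HasEigenvalue (Matrix.toLin' (M * Mᵀ)) l → C < l) (i j : Fin p) :
    |(M * Mᵀ)⁻¹ i j| ≤ C⁻¹ := by
  set G := M * Mᵀ with hG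
  have hGh : G.IsHermitian := by
    rw [Matrix.IsHermitian, Matrix.conjTranspose_eq_transpose_of_trivial, hG,
      Matrix.transpose_mul, Matrix.transpose_transpose]
  have hsub : (G - C • (1 : Matrix (Fin p) (Fin p) ℝ)).IsHermitian :=
    hGh.sub (by simp [Matrix.IsHermitian])
  have hpsd : (G - C • (1 : Matrix (Fin p) (Fin p) ℝ)).PosSemidef := by
    refine hsub.posSemidef_iff_eigenvalues_nonneg.2 fun k => ?_
    have hv := hsub.mulVec_eigenvectorBasis k
    have hne : (hsub.eigenvectorBasis k).ofLp ≠ 0 := fun h0 =>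
      hsub.eigenvectorBasis.orthonormal.ne_zero k (by ext i; exact congrFun h0 i)
    have hev : Module.End.HasEigenvalue (Matrix.toLin' G) (hsub.eigenvalues k + C) := by
      refine Module.End.hasEigenvalue_of_hasEigenvector
        (x := (hsub.eigenvectorBasis k).ofLp) ⟨Module.End.mem_eigenspace_iff.2 ?_, hne⟩
      rw [Matrix.sub_mulVec, Matrix.smul_mulVec, Matrix.one_mulVec, sub_eq_iff_eq_add] at hv
      rw [Matrix.toLin'_apply, hv, add_smul]
    have := h _ hev
    simp only [Pi.zero_apply]
    linarith
  have hquad : ∀ y : Fin p → ℝ, C * (y ⬝ᵥ y) ≤ y ⬝ᵥ (G *ᵥ y) := by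
    intro y
    have := hpsd.dotProduct_mulVec_nonneg y
    rw [Matrix.sub_mulVec, Matrix.smul_mulVec, Matrix.one_mulVec, dotProduct_sub,
      dotProduct_smul, star_trivial, smul_eq_mul] at this
    linarith
  have hdet : IsUnit G.det := by
    rw [isUnit_iff_ne_zero]
    intro h0
    obtain ⟨v, hv, hGv⟩ := Matrix.exists_mulVec_eq_zero_iff.2 h0
    have h1 := hquad v
    rw [hGv, dotProduct_zero] at h1
    have h2 : 0 < v ⬝ᵥ v := by simpa using Matrix.dotProduct_star_self_pos_iff.2 hv
    nlinarith
  set y : Fin p → ℝ := G⁻¹ *ᵥ Pi.single j 1 with hy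
  have hyi : ∀ i, y i = G⁻¹ i j := fun i => by simp [hy]
  have hGy : G *ᵥ y = Pi.single j 1 := by
    rw [hy, Matrix.mulVec_mulVec, Matrix.mul_nonsing_inv _ hdet, Matrix.one_mulVec]
  have h1 := hquad y
  rw [hGy, dotProduct_single, mul_one] at h1
  have hle : ∀ i, y i ^ 2 ≤ y ⬝ᵥ y := fun i => by
    rw [sq]
    exact Finset.single_le_sum (f := fun i => y i * y i) (fun i _ => mul_self_nonneg (y i))
      (Finset.mem_univ i)
  have hj : C * y j ^ 2 ≤ y j := (mul_le_mul_of_nonneg_left (hle j) hC.le).trans h1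
  have hi : C * y i ^ 2 ≤ y j := (mul_le_mul_of_nonneg_left (hle i) hC.le).trans h1
  rw [← hyi i]
  have hCC : C * C⁻¹ = 1 := mul_inv_cancel₀ hC.ne'
  have hyj : y j ≤ C⁻¹ := by
    by_contra hcon
    push Not at hcon
    have : 0 < C⁻¹ := inv_pos.2 hC
    nlinarith [mul_lt_mul_of_pos_left hcon hC]
  have : y i ^ 2 ≤ C⁻¹ ^ 2 := by
    have : C * y i ^ 2 ≤ C * C⁻¹ ^ 2 := by
      calc C * y i ^ 2 ≤ C⁻¹ := hi.trans hyj
        _ = C * C⁻¹ ^ 2 := by rw [sq, ← mul_assoc, hCC, one_mul]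
    exact le_of_mul_le_mul_left this hC
  exact abs_le_of_sq_le_sq this (inv_pos.2 hC).le

lemma Matrix.measurable_inv_apply {p : ℕ} {A : ℝ → Matrix (Fin p) (Fin p) ℝ}
    (hA : ∀ i j, Measurable fun r => A r i j) (i j : Fin p) :
    Measurable fun r => (A r)⁻¹ i j := by
  have hdet : ∀ {n : ℕ} {B : ℝ → Matrix (Fin n) (Fin n) ℝ},
      (∀ i j, Measurable fun r => B r i j) → Measurable fun r => (B r).det := by
    intro n B hB
    simp only [Matrix.det_apply]
    exact Finset.measurable_sum _ fun τ _ =>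
      (Finset.measurable_prod _ fun i _ => hB _ _).const_smul _
  simp only [Matrix.inv_def, Matrix.smul_apply, Ring.inverse_eq_inv', smul_eq_mul,
    Matrix.adjugate_apply]
  refine (hdet hA).inv.mul (hdet fun k l => ?_)
  by_cases hk : k = j
  · subst hk
    simp
  · simpa [Matrix.updateRow_ne hk] using hA k l

section Coefficients

variable {d₁ d₂ m₁ m₂ : ℕ} {a : ℝ → Matrix (Fin d₁) (Fin d₁) ℝ}
  {b : ℝ → Matrix (Fin d₁) (Fin m₁) ℝ} {c : ℝ → Matrix (Fin d₂) (Fin d₁) ℝ}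
  {σ : ℝ → Matrix (Fin d₂) (Fin m₂) ℝ}

lemma LinearCoefficients.matrixIntegrableOn_a (h : LinearCoefficients a b c σ) {t : ℝ}
    (ht : 0 ≤ t) : MatrixIntegrableOn a 0 t := fun i j => h.integrable_a t ht i j

lemma LinearCoefficients.intervalIntegrable_mul_b (h : LinearCoefficients a b c σ) {t : ℝ}
    (ht : 0 ≤ t) (i j : Fin d₁) (k : Fin m₁) :
    IntervalIntegrable (fun r => b r i k * b r j k) volume 0 t :=
  .mul_of_sq (h.measurable_b i k) (h.measurable_b j k) (h.integrable_b t ht i k)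
    (h.integrable_b t ht j k)

lemma LinearCoefficients.matrixIntegrableOn_mul_transpose_b (h : LinearCoefficients a b c σ)
    {t : ℝ} (ht : 0 ≤ t) : MatrixIntegrableOn (fun r => b r * (b r)ᵀ) 0 t := fun i j => by
  have := IntervalIntegrable.sum Finset.univ fun k (_ : k ∈ Finset.univ) =>
    h.intervalIntegrable_mul_b ht i j k
  exact this.congr fun r _ => by simp [Matrix.mul_apply]

/-- Nondegeneracy of `σ σᵀ` makes `cᵀ (σ σᵀ)⁻¹ c` integrable. -/
lemma LinearCoefficients.matrixIntegrableOn_quadratic_c (h : LinearCoefficients a b c σ)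
    {t : ℝ} (ht : 0 ≤ t) :
    MatrixIntegrableOn (fun r => (c r)ᵀ * (σ r * (σ r)ᵀ)⁻¹ * c r) 0 t := fun i j => by
  obtain ⟨C, hC, hev⟩ := h.nondegenerate
  have hmeas : ∀ k l, Measurable fun r => (σ r * (σ r)ᵀ)⁻¹ k l :=
    Matrix.measurable_inv_apply fun i j => by
      simp only [Matrix.mul_apply, Matrix.transpose_apply]
      exact Finset.measurable_sum _ fun k _ => (h.measurable_σ i k).mul (h.measurable_σ j k)
  have hterm : ∀ k l, IntervalIntegrable
      (fun r => c r k i * c r l j * (σ r * (σ r)ᵀ)⁻¹ k l) volume 0 t := fun k l => by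
    have hcc := IntervalIntegrable.mul_of_sq (h.measurable_c k i) (h.measurable_c l j)
      (h.integrable_c t ht k i) (h.integrable_c t ht l j)
    rw [intervalIntegrable_iff_integrableOn_Ioc_of_le ht] at hcc ⊢
    refine Integrable.mul_bdd (c := C⁻¹) hcc (hmeas k l).aestronglyMeasurable ?_
    refine (ae_restrict_iff' measurableSet_Ioc).2 (Eventually.of_forall fun r hr => ?_)
    exact Matrix.abs_inv_mul_transpose_apply_le _ hC (hev r hr.1.le) k l
  have := IntervalIntegrable.sum Finset.univ fun l (_ : l ∈ Finset.univ) =>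
    IntervalIntegrable.sum Finset.univ fun k (_ : k ∈ Finset.univ) => hterm k l
  refine this.congr fun r _ => ?_
  simp only [Finset.sum_apply, Matrix.mul_apply, Matrix.transpose_apply, Finset.sum_mul]
  exact Finset.sum_congr rfl fun l _ => Finset.sum_congr rfl fun k _ => by ring

end Coefficients

/-! ### The Riccati and Lyapunov equations -/

section Riccati

variable {d₁ d₂ m₁ m₂ : ℕ} {a : ℝ → Matrix (Fin d₁) (Fin d₁) ℝ}
  {b : ℝ → Matrix (Fin d₁) (Fin m₁) ℝ} {c : ℝ → Matrix (Fin d₂) (Fin d₁) ℝ}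
  {σ : ℝ → Matrix (Fin d₂) (Fin m₂) ℝ} {t : ℝ} {φ γ : ℝ → Matrix (Fin d₁) (Fin d₁) ℝ}

lemma IsBackwardRiccatiSolution.isMatrixPrimitiveOn (hcoef : LinearCoefficients a b c σ)
    (ht : 0 ≤ t) (hφ : IsBackwardRiccatiSolution a b c σ t φ) :
    IsMatrixPrimitiveOn φ (fun r => -(φ r * (b r * (b r)ᵀ) * φ r) - (a r)ᵀ * φ r - φ r * a r
      + (c r)ᵀ * (σ r * (σ r)ᵀ)⁻¹ * c r) 0 t := by
  have hβ := hcoef.matrixIntegrableOn_mul_transpose_b ht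
  have ha := hcoef.matrixIntegrableOn_a ht
  have hint : MatrixIntegrableOn (fun r => -(φ r * (b r * (b r)ᵀ) * φ r) - (a r)ᵀ * φ r - φ r * a r
      + (c r)ᵀ * (σ r * (σ r)ᵀ)⁻¹ * c r) 0 t := by
    simp only [sub_eq_add_neg]
    exact ((((hβ.continuousOn_mul ht hφ.continuousOn).mul_continuousOn ht hφ.continuousOn).neg.add
      (ha.transpose.mul_continuousOn ht hφ.continuousOn).neg).add
      (ha.continuousOn_mul ht hφ.continuousOn).neg).add (hcoef.matrixIntegrableOn_quadratic_c ht)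
  refine IsMatrixPrimitiveOn.of_matrixIntegral ht hint (φ 0) fun s hs => ?_
  have h0 : (0 : ℝ) ∈ Icc 0 t := ⟨le_rfl, ht⟩
  have h1 : t ∈ Icc 0 t := ⟨ht, le_rfl⟩
  rw [hφ.equation s hs, hφ.equation 0 h0]
  ext i j
  simp only [matrixIntegral, Matrix.neg_apply, Matrix.add_apply, Matrix.of_apply, ← Matrix.mul_assoc]
  have h := intervalIntegral.integral_add_adjacent_intervals ((hint i j).mono_Icc h0 hs)
    ((hint i j).mono_Icc hs h1)
  simp only [← Matrix.mul_assoc, Matrix.add_apply] at h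
  linarith

lemma IsForwardRiccatiSolution.isMatrixPrimitiveOn (hcoef : LinearCoefficients a b c σ)
    (ht : 0 ≤ t) {S : Matrix (Fin d₁) (Fin d₁) ℝ} (hγ : IsForwardRiccatiSolution a b c σ S t γ) :
    IsMatrixPrimitiveOn γ (fun r => -(γ r * ((c r)ᵀ * (σ r * (σ r)ᵀ)⁻¹ * c r) * γ r)
      + a r * γ r + γ r * (a r)ᵀ + b r * (b r)ᵀ) 0 t := by
  have hβ := hcoef.matrixIntegrableOn_mul_transpose_b ht
  have ha := hcoef.matrixIntegrableOn_a ht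
  refine IsMatrixPrimitiveOn.of_matrixIntegral ht ?_ S fun s hs => ?_
  · exact (((((hcoef.matrixIntegrableOn_quadratic_c ht).continuousOn_mul ht
      hγ.continuousOn).mul_continuousOn ht hγ.continuousOn).neg.add
      (ha.mul_continuousOn ht hγ.continuousOn)).add
      (ha.transpose.continuousOn_mul ht hγ.continuousOn)).add hβ
  · rw [hγ.equation s hs]
    simp only [← Matrix.mul_assoc]

lemma IsForwardRiccatiSolution.init {S : Matrix (Fin d₁) (Fin d₁) ℝ} (ht : 0 ≤ t)
    (hγ : IsForwardRiccatiSolution a b c σ S t γ) : γ 0 = S := by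
  rw [hγ.equation 0 ⟨le_rfl, ht⟩]
  ext i j
  simp [matrixIntegral]

lemma IsBackwardRiccatiSolution.transpose_eq (hφ : IsBackwardRiccatiSolution a b c σ t φ) {s : ℝ}
    (hs : s ∈ Icc 0 t) : (φ s)ᵀ = φ s := by
  have := (hφ.negSemidef s hs).isHermitian
  rwa [Matrix.IsHermitian, Matrix.conjTranspose_eq_transpose_of_trivial, Matrix.transpose_neg,
    neg_inj] at this

end Riccati

section Algebra

variable {d : ℕ} {t : ℝ} {a β κ φ γ V : ℝ → Matrix (Fin d) (Fin d) ℝ}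

/-- If `φ` and `γ` solve the backward and the forward Riccati equation, and `V` solves the Lyapunov
equation with drift `a + β φ`, then the relation `V (1 - φ γ) = γ`, which says that
`V = (γ⁻¹ - φ)⁻¹`, propagates from time `0`: the defect `V (1 - φ γ) - γ` solves a homogeneous
linear equation. -/
theorem lyapunov_mul_one_sub_eq (ht : 0 ≤ t) (ha : MatrixIntegrableOn a 0 t)
    (hβ : MatrixIntegrableOn β 0 t) (hκ : MatrixIntegrableOn κ 0 t)
    (hφ : IsMatrixPrimitiveOn φ
      (fun r => -(φ r * β r * φ r) - (a r)ᵀ * φ r - φ r * a r + κ r) 0 t)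
    (hγ : IsMatrixPrimitiveOn γ
      (fun r => -(γ r * κ r * γ r) + a r * γ r + γ r * (a r)ᵀ + β r) 0 t)
    (hV : IsMatrixPrimitiveOn V
      (fun r => (a r + β r * φ r) * V r + V r * ((a r)ᵀ + φ r * β r) + β r) 0 t)
    (h0 : V 0 * (1 - φ 0 * γ 0) = γ 0) {s : ℝ} (hs : s ∈ Icc 0 t) :
    V s * (1 - φ s * γ s) = γ s := by
  have hQ := (hV.mul ht ((IsMatrixPrimitiveOn.const ht 1).sub (hφ.mul ht hγ))).sub hγ
  have hQ' : IsMatrixPrimitiveOn (fun r => V r * (1 - φ r * γ r) - γ r)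
      (fun r => (a r + β r * φ r) * (V r * (1 - φ r * γ r) - γ r)
        + (V r * (1 - φ r * γ r) - γ r) * ((a r)ᵀ + -(κ r * γ r))) 0 t :=
    hQ.congr (fun _ _ => rfl) fun r _ => by noncomm_ring
  exact sub_eq_zero.1 (hQ'.eq_zero ht (ha.add (hβ.mul_continuousOn ht hφ.continuousOn))
    (ha.transpose.add (hκ.mul_continuousOn ht hγ.continuousOn).neg) (sub_eq_zero.2 h0) hs)

/-- Where `γ` is nonsingular and `V (1 - φ γ) = γ`, multiplication by the solution `V` of the
Lyapunov equation with drift `a + β φ` carries the transition matrix of `-(aᵀ + γ⁻¹ β)` to a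
solution of the linear equation with drift `a + β φ`. -/
theorem eq_lyapunov_mul_orderedExp {u t : ℝ} (hut : u ≤ t) (ha : MatrixIntegrableOn a u t)
    (hβ : MatrixIntegrableOn β u t) (hφ : ContinuousOn φ (Icc u t)) (hγ : ContinuousOn γ (Icc u t))
    (hunit : ∀ r ∈ Icc u t, IsUnit (γ r))
    (hV : IsMatrixPrimitiveOn V
      (fun r => (a r + β r * φ r) * V r + V r * ((a r)ᵀ + φ r * β r) + β r) u t)
    (hVγ : ∀ r ∈ Icc u t, V r * (1 - φ r * γ r) = γ r)
    {N : ℝ → Matrix (Fin d) (Fin d) ℝ}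
    (hN : IsMatrixPrimitiveOn N (fun r => (a r + β r * φ r) * N r) u t) (hNu : N u = V u)
    {s : ℝ} (hs : s ∈ Icc u t) :
    N s = V s * orderedExp (fun r => -((a r)ᵀ + (γ r)⁻¹ * β r)) u s := by
  have hinv : ∀ r ∈ Icc u t, V r * (γ r)⁻¹ = 1 + V r * φ r := fun r hr => by
    have hdet := (Matrix.isUnit_iff_isUnit_det _).1 (hunit r hr)
    have h := congrArg (· * (γ r)⁻¹) (hVγ r hr)
    simp only [Matrix.mul_nonsing_inv _ hdet, mul_sub, sub_mul, mul_one, mul_assoc] at h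
    exact sub_eq_iff_eq_add.1 h
  have hγinv : ContinuousOn (fun r => (γ r)⁻¹) (Icc u t) := by
    have hdet : ContinuousOn (fun r => (γ r).det) (Icc u t) :=
      (continuous_id.matrix_det).comp_continuousOn hγ
    have hadj : ContinuousOn (fun r => (γ r).adjugate) (Icc u t) :=
      (continuous_id.matrix_adjugate).comp_continuousOn hγ
    simp only [Matrix.inv_def, Ring.inverse_eq_inv']
    exact (hdet.inv₀ fun r hr =>
      ((Matrix.isUnit_iff_isUnit_det _).1 (hunit r hr)).ne_zero).smul hadj
  have hE := isMatrixPrimitiveOn_orderedExp hut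
    (ha.transpose.add (hβ.continuousOn_mul hut hγinv)).neg
  have hD := hN.sub (hV.mul hut hE)
  set E := orderedExp (fun r => -((a r)ᵀ + (γ r)⁻¹ * β r)) u with hEdef
  have hD' : IsMatrixPrimitiveOn (fun r => N r - V r * E r)
      (fun r => (a r + β r * φ r) * (N r - V r * E r) + (N r - V r * E r) * 0) u t := by
    refine hD.congr (fun _ _ => rfl) fun r hr => ?_
    have h1 : V r * (-((a r)ᵀ + (γ r)⁻¹ * β r) * E r)
        = -(V r * (a r)ᵀ * E r) - (V r * (γ r)⁻¹) * β r * E r := by noncomm_ring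
    rw [h1, hinv r hr]
    noncomm_ring
  refine sub_eq_zero.1 (hD'.eq_zero (R := fun _ => 0) hut
    (ha.add (hβ.mul_continuousOn hut hφ)) (fun _ _ => intervalIntegrable_const) ?_ hs)
  rw [hNu, hEdef, orderedExp_self, mul_one, sub_self]

/-- Variation of constants for the Lyapunov equation. -/
lemma isMatrixPrimitiveOn_lyapunov (ht : 0 ≤ t) {A Φ Ψ U : ℝ → Matrix (Fin d) (Fin d) ℝ}
    (hΦ : IsMatrixPrimitiveOn Φ (fun r => A r * Φ r) 0 t)
    (hU : IsMatrixPrimitiveOn U (fun r => Ψ r * β r * (Ψ r)ᵀ) 0 t)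
    (hΦΨ : ∀ s ∈ Icc 0 t, Φ s * Ψ s = 1) :
    IsMatrixPrimitiveOn (fun r => Φ r * U r * (Φ r)ᵀ)
      (fun r => A r * (Φ r * U r * (Φ r)ᵀ) + Φ r * U r * (Φ r)ᵀ * (A r)ᵀ + β r) 0 t := by
  refine ((hΦ.mul ht hU).mul ht hΦ.transpose).congr (fun _ _ => rfl) fun r hr => ?_
  have h1 : Φ r * (Ψ r * β r * (Ψ r)ᵀ) * (Φ r)ᵀ = β r := by
    calc Φ r * (Ψ r * β r * (Ψ r)ᵀ) * (Φ r)ᵀ = (Φ r * Ψ r) * β r * (Φ r * Ψ r)ᵀ := by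
          rw [Matrix.transpose_mul]; noncomm_ring
      _ = β r := by rw [hΦΨ r hr]; simp
  rw [Matrix.transpose_mul, add_mul, h1]
  noncomm_ring

/-- The covariance `S^{1/2} (1 - S^{1/2} φ S^{1/2})⁻¹ S^{1/2}` is `S (1 - φ S)⁻¹`. -/
lemma sqrt_mul_inv_mul_sqrt_mul {S f : Matrix (Fin d) (Fin d) ℝ} (hS : S.PosSemidef)
    (hf : (-f).PosSemidef) :
    CFC.sqrt S * (1 - CFC.sqrt S * f * CFC.sqrt S)⁻¹ * CFC.sqrt S * (1 - f * S) = S := by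
  set R := CFC.sqrt S with hR
  have hRR : R * R = S := CFC.sqrt_mul_sqrt_self S hS.nonneg
  have hRh : Rᴴ = R := (Matrix.nonneg_iff_posSemidef.1 (CFC.sqrt_nonneg S)).isHermitian
  have hpd : (1 - R * f * R).PosDef := by
    have h1 : (R * (-f) * R).PosSemidef := by
      have := hf.mul_mul_conjTranspose_same R
      rwa [hRh] at this
    have h2 := Matrix.PosDef.one.add_posSemidef h1
    convert! h2 using 1
    noncomm_ring
  have hu : IsUnit (1 - R * f * R).det := (Matrix.isUnit_iff_isUnit_det _).1 hpd.isUnit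
  calc R * (1 - R * f * R)⁻¹ * R * (1 - f * S)
      = R * ((1 - R * f * R)⁻¹ * (1 - R * f * R)) * R := by rw [← hRR]; noncomm_ring
    _ = S := by rw [Matrix.nonsing_inv_mul _ hu, mul_one, hRR]

end Algebra

/-! ### Covariances of Wiener integrals -/

lemma tendsto_integral_mul_of_tendsto_eLpNorm {α : Type*} [MeasurableSpace α] {μ : Measure α}
    {f g : α → ℝ} {F G : ℕ → α → ℝ} (hf : MemLp f 2 μ) (hg : MemLp g 2 μ)
    (hF : ∀ n, MemLp (F n) 2 μ) (hG : ∀ n, MemLp (G n) 2 μ)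
    (hfF : Tendsto (fun n => eLpNorm (fun x => f x - F n x) 2 μ) atTop (𝓝 0))
    (hgG : Tendsto (fun n => eLpNorm (fun x => g x - G n x) 2 μ) atTop (𝓝 0)) :
    Tendsto (fun n => ∫ x, F n x * G n x ∂μ) atTop (𝓝 (∫ x, f x * g x ∂μ)) := by
  have hlim : ∀ {h : α → ℝ} {H : ℕ → α → ℝ} (hh : MemLp h 2 μ) (hH : ∀ n, MemLp (H n) 2 μ),
      Tendsto (fun n => eLpNorm (fun x => h x - H n x) 2 μ) atTop (𝓝 0) →
      Tendsto (fun n => (hH n).toLp (H n)) atTop (𝓝 (hh.toLp h)) := by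
    intro h H hh hH hhH
    refine (Lp.tendsto_Lp_iff_tendsto_eLpNorm'' H hH h hh).2 (hhH.congr fun n => ?_)
    rw [← eLpNorm_sub_comm]
    rfl
  have hin : ∀ {h k : α → ℝ} (hh : MemLp h 2 μ) (hk : MemLp k 2 μ),
      inner ℝ (hh.toLp h) (hk.toLp k) = ∫ x, h x * k x ∂μ := by
    intro h k hh hk
    rw [L2.inner_def]
    refine integral_congr_ae ?_
    filter_upwards [hh.coeFn_toLp, hk.coeFn_toLp] with x h1 h2
    simp [h1, h2, mul_comm]
  simpa only [hin] using (hlim hf hF hfF).inner (𝕜 := ℝ) (hlim hg hG hgG)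

section Probability

variable {Ω : Type*} [MeasurableSpace Ω] {P : Measure Ω}

lemma memLp_two_increment {B : ℝ≥0 → Ω → ℝ} (hB : IsPreBrownianReal B P) (p q : ℝ≥0) :
    MemLp (fun ω => B q ω - B p ω) 2 P :=
  (hB.isGaussianProcess.hasGaussianLaw_eval q).memLp_two.sub
    (hB.isGaussianProcess.hasGaussianLaw_eval p).memLp_two

lemma StepFunction.memLp_integral {s : ℝ≥0} {B : ℝ≥0 → Ω → ℝ} (hB : IsPreBrownianReal B P)
    (g : StepFunction s) : MemLp (g.integral B) 2 P :=
  memLp_finsetSum _ fun _ _ => (memLp_two_increment hB _ _).const_mul _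

variable [IsProbabilityMeasure P]

lemma tendsto_integral_of_tendsto_eLpNorm_two {f : Ω → ℝ} {F : ℕ → Ω → ℝ} (hf : MemLp f 2 P)
    (hF : ∀ n, MemLp (F n) 2 P)
    (hfF : Tendsto (fun n => eLpNorm (fun x => f x - F n x) 2 P) atTop (𝓝 0)) :
    Tendsto (fun n => ∫ x, F n x ∂P) atTop (𝓝 (∫ x, f x ∂P)) := by
  simpa using tendsto_integral_mul_of_tendsto_eLpNorm (g := fun _ => 1) (G := fun _ _ => 1) hf
    (memLp_const 1) hF (fun _ => memLp_const 1) hfF (by simp)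

lemma tendsto_covariance_of_tendsto_eLpNorm {f g : Ω → ℝ} {F G : ℕ → Ω → ℝ} (hf : MemLp f 2 P)
    (hg : MemLp g 2 P) (hF : ∀ n, MemLp (F n) 2 P) (hG : ∀ n, MemLp (G n) 2 P)
    (hfF : Tendsto (fun n => eLpNorm (fun x => f x - F n x) 2 P) atTop (𝓝 0))
    (hgG : Tendsto (fun n => eLpNorm (fun x => g x - G n x) 2 P) atTop (𝓝 0)) :
    Tendsto (fun n => cov[F n, G n; P]) atTop (𝓝 cov[f, g; P]) := by
  simp only [covariance_eq_sub (hF _) (hG _), covariance_eq_sub hf hg]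
  exact (tendsto_integral_mul_of_tendsto_eLpNorm hf hg hF hG hfF hgG).sub
    ((tendsto_integral_of_tendsto_eLpNorm_two hf hF hfF).mul
      (tendsto_integral_of_tendsto_eLpNorm_two hg hG hgG))

namespace StepFunction

variable {s v : ℝ≥0} {B : ℝ≥0 → Ω → ℝ}

lemma integral_integral (hB : IsPreBrownianReal B P) (g : StepFunction s) :
    ∫ ω, g.integral B ω ∂P = 0 := by
  simp only [integral]
  rw [integral_finsetSum _ fun k _ =>
    ((memLp_two_increment hB _ _).integrable one_le_two).const_mul _]
  refine Finset.sum_eq_zero fun k _ => ?_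
  rw [integral_const_mul, integral_sub (hB.integrable_eval _) (hB.integrable_eval _),
    hB.integral_eval, hB.integral_eval, sub_zero, mul_zero]

lemma memLp_eval (g : StepFunction s) : MemLp g.eval 2 volume :=
  memLp_finsetSum _ fun k _ => memLp_indicator_const _ measurableSet_Ioc _ (Or.inr (by simp))

lemma eval_eq_zero (g : StepFunction s) {r : ℝ} (hr : r ∉ Ioc 0 (s : ℝ)) : g.eval r = 0 :=
  Finset.sum_eq_zero fun k _ => indicator_of_notMem (fun h => hr
    ⟨(g.τ k).2.trans_lt h.1, h.2.trans (by exact_mod_cast g.le (k + 1))⟩) _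

/-- The covariance of two increments of a Brownian motion is the length of the intersection of the
two time intervals. -/
lemma covariance_increments (hB : IsPreBrownianReal B P) {p p' q q' : ℝ≥0} (hp : p ≤ p')
    (hq : q ≤ q') :
    cov[fun ω => B p' ω - B p ω, fun ω => B q' ω - B q ω; P]
      = ∫ r, (Ioc (p : ℝ) p').indicator (fun _ => (1 : ℝ)) r
          * (Ioc (q : ℝ) q').indicator (fun _ => (1 : ℝ)) r := by
  have hm : ∀ r, MemLp (fun ω => B r ω) 2 P := fun r =>
    (hB.isGaussianProcess.hasGaussianLaw_eval r).memLp_two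
  rw [covariance_fun_sub_fun_sub (hm _) (hm _) (hm _) (hm _)]
  simp only [hB.covariance_fun_eval, ← inter_indicator_mul, mul_one, Ioc_inter_Ioc]
  rw [integral_indicator measurableSet_Ioc, setIntegral_const, smul_eq_mul, mul_one,
    Real.volume_real_Ioc, NNReal.coe_min, NNReal.coe_min, NNReal.coe_min, NNReal.coe_min]
  have hp' : (p : ℝ) ≤ p' := by exact_mod_cast hp
  have hq' : (q : ℝ) ≤ q' := by exact_mod_cast hq
  grind

lemma covariance_integral (hB : IsPreBrownianReal B P) (g : StepFunction s) (h : StepFunction v) :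
    cov[g.integral B, h.integral B; P] = ∫ r, g.eval r * h.eval r := by
  have hind : ∀ p q x p' q' x' : ℝ, Integrable (fun r =>
      (Ioc p q).indicator (fun _ => x) r * (Ioc p' q').indicator (fun _ => x') r) volume := by
    intro p q x p' q' x'
    exact MemLp.integrable_mul (memLp_indicator_const 2 measurableSet_Ioc _ (Or.inr (by simp)))
      (memLp_indicator_const 2 measurableSet_Ioc _ (Or.inr (by simp)))
  have hleft : cov[g.integral B, h.integral B; P]
      = ∑ k ∈ Finset.range g.n, ∑ l ∈ Finset.range h.n, g.c k * (h.c l *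
        ∫ r, (Ioc (g.τ k : ℝ) (g.τ (k + 1))).indicator (fun _ => (1 : ℝ)) r
          * (Ioc (h.τ l : ℝ) (h.τ (l + 1))).indicator (fun _ => (1 : ℝ)) r) := by
    change cov[fun ω => ∑ k ∈ Finset.range g.n, _, fun ω => ∑ l ∈ Finset.range h.n, _; P] = _
    rw [covariance_fun_sum_fun_sum' (fun k _ => (memLp_two_increment hB _ _).const_mul _)
      (fun l _ => (memLp_two_increment hB _ _).const_mul _)]
    refine Finset.sum_congr rfl fun k _ => Finset.sum_congr rfl fun l _ => ?_
    rw [covariance_const_mul_left, covariance_const_mul_right,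
      covariance_increments hB (g.mono k.le_succ) (h.mono l.le_succ)]
  rw [hleft]
  simp only [eval, Finset.sum_mul_sum]
  rw [integral_finsetSum _ fun k _ => integrable_finsetSum _ fun l _ =>
    hind _ _ _ _ _ _]
  refine Finset.sum_congr rfl fun k _ => ?_
  rw [integral_finsetSum _ fun l _ => hind _ _ _ _ _ _]
  refine Finset.sum_congr rfl fun l _ => ?_
  rw [← integral_const_mul, ← integral_const_mul]
  refine integral_congr_ae (Eventually.of_forall fun r => ?_)
  simp only [indicator]
  split_ifs <;> ring

lemma measurable_integral_path (g : StepFunction s) :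
    Measurable fun x : ℝ≥0 → ℝ => g.integral (fun r x => x r) x := by
  unfold integral
  fun_prop

end StepFunction

namespace IsWienerIntegral

variable {s v : ℝ≥0} {B B' : ℝ≥0 → Ω → ℝ} {f g : ℝ → ℝ} {J K : Ω → ℝ}

lemma integral_eq_zero (hB : IsPreBrownianReal B P) (hJ : IsWienerIntegral P B f s J) :
    ∫ ω, J ω ∂P = 0 := by
  obtain ⟨hJm, F, -, hF⟩ := hJ
  refine tendsto_nhds_unique (tendsto_integral_of_tendsto_eLpNorm_two hJm
    (fun n => (F n).memLp_integral hB) hF) ?_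
  simp only [StepFunction.integral_integral hB]
  exact tendsto_const_nhds

/-- The Itô isometry for Wiener integrals over two time intervals. -/
theorem covariance_eq (hB : IsPreBrownianReal B P) (hJ : IsWienerIntegral P B f s J)
    (hK : IsWienerIntegral P B g v K) (hf : MemLp f 2 (volume.restrict (Ioc 0 (s : ℝ))))
    (hg : MemLp g 2 (volume.restrict (Ioc 0 (v : ℝ)))) :
    cov[J, K; P] = ∫ r in (0 : ℝ)..min (s : ℝ) v, f r * g r := by
  obtain ⟨hJm, F, hfF, hF⟩ := hJ
  obtain ⟨hKm, G, hgG, hG⟩ := hK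
  have hext : ∀ {w : ℝ≥0} {h : ℝ → ℝ} (H : StepFunction w),
      eLpNorm (fun r => (Ioc 0 (w : ℝ)).indicator h r - H.eval r) 2 volume
        = eLpNorm (fun r => h r - H.eval r) 2 (volume.restrict (Ioc 0 (w : ℝ))) := by
    intro w h H
    rw [← eLpNorm_indicator_eq_eLpNorm_restrict measurableSet_Ioc]
    congr 1
    ext r
    by_cases hr : r ∈ Ioc 0 (w : ℝ)
    · simp [hr]
    · simp [hr, H.eval_eq_zero hr]
  have h1 := tendsto_covariance_of_tendsto_eLpNorm hJm hKm (fun n => (F n).memLp_integral hB)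
    (fun n => (G n).memLp_integral hB) hF hG
  have h2 := tendsto_integral_mul_of_tendsto_eLpNorm
    ((memLp_indicator_iff_restrict measurableSet_Ioc).2 hf)
    ((memLp_indicator_iff_restrict measurableSet_Ioc).2 hg) (fun n => (F n).memLp_eval)
    (fun n => (G n).memLp_eval) (by simpa only [hext] using hfF) (by simpa only [hext] using hgG)
  simp only [StepFunction.covariance_integral hB] at h1
  rw [tendsto_nhds_unique h1 h2, intervalIntegral.integral_of_le (le_min s.coe_nonneg v.coe_nonneg),
    ← integral_indicator measurableSet_Ioc]
  simp only [← inter_indicator_mul, Ioc_inter_Ioc, max_self]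

lemma covariance_eq_zero_of_indepFun {Y : Ω → ℝ} (hB : IsPreBrownianReal B P)
    (hJ : IsWienerIntegral P B f s J) (hY : MemLp Y 2 P)
    (hind : IndepFun (fun ω r => B r ω) Y P) : cov[J, Y; P] = 0 := by
  obtain ⟨hJm, F, -, hF⟩ := hJ
  have h1 := tendsto_covariance_of_tendsto_eLpNorm (G := fun _ => Y) hJm hY
    (fun n => (F n).memLp_integral hB) (fun _ => hY) hF (by simp)
  refine tendsto_nhds_unique h1 ?_
  have : ∀ n, cov[(F n).integral B, Y; P] = 0 := fun n =>
    (hind.comp (F n).measurable_integral_path measurable_id).covariance_eq_zero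
      ((F n).memLp_integral hB) hY
  simp only [this]
  exact tendsto_const_nhds

lemma covariance_eq_zero_of_indepFun_path (hB : IsPreBrownianReal B P)
    (hB' : IsPreBrownianReal B' P) (hJ : IsWienerIntegral P B f s J)
    (hK : IsWienerIntegral P B' g v K)
    (hind : IndepFun (fun ω r => B r ω) (fun ω r => B' r ω) P) : cov[J, K; P] = 0 := by
  obtain ⟨hKm, G, -, hG⟩ := hK
  have h1 := tendsto_covariance_of_tendsto_eLpNorm (F := fun _ => J) hJ.1 hKm
    (fun _ => hJ.1) (fun n => (G n).memLp_integral hB') (by simp) hG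
  refine tendsto_nhds_unique h1 ?_
  have : ∀ n, cov[J, (G n).integral B'; P] = 0 := fun n =>
    hJ.covariance_eq_zero_of_indepFun hB ((G n).memLp_integral hB')
      (hind.comp measurable_id (G n).measurable_integral_path)
  simp only [this]
  exact tendsto_const_nhds

end IsWienerIntegral

end Probability

/-! ### Time integrals of continuous processes -/

/-- A real process on `[0, t]` whose paths are all continuous. -/
structure IsContinuousProcessOn {Ω : Type*} [MeasurableSpace Ω] (Z : ℝ → Ω → ℝ) (t : ℝ) :
    Prop where
  measurable : ∀ r ∈ Icc 0 t, Measurable (Z r)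
  continuousOn : ∀ ω, ContinuousOn (fun r => Z r ω) (Icc 0 t)

section TimeIntegral

variable {Ω : Type*} [MeasurableSpace Ω] {P : Measure Ω}
  {Z : ℝ → Ω → ℝ} {t s M : ℝ} {w : ℝ → ℝ} {Y : Ω → ℝ}

namespace IsContinuousProcessOn

lemma measurable_projIcc (ht : 0 ≤ t) (hZ : IsContinuousProcessOn Z t) :
    Measurable fun p : ℝ × Ω => Z (projIcc 0 t ht p.1) p.2 :=
  measurable_uncurry_of_continuous_of_measurable (u := fun r ω => Z (projIcc 0 t ht r) ω)
    (fun ω => ((hZ.continuousOn ω).domRestrict.comp continuous_projIcc))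
    (fun r => hZ.measurable _ (projIcc 0 t ht r).2)

lemma aestronglyMeasurable_prod (hZ : IsContinuousProcessOn Z t) (hs : s ∈ Icc 0 t) :
    AEStronglyMeasurable (fun p : ℝ × Ω => Z p.1 p.2) ((volume.restrict (Ioc 0 s)).prod P) := by
  refine ((hZ.measurable_projIcc (hs.1.trans hs.2)).aestronglyMeasurable).congr ?_
  have h : ∀ᵐ p ∂((volume.restrict (Ioc 0 s)).prod P), p.1 ∈ Ioc 0 s :=
    Measure.quasiMeasurePreserving_fst.ae (ae_restrict_mem measurableSet_Ioc)
  filter_upwards [h] with p hp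
  rw [projIcc_of_mem (hs.1.trans hs.2) ⟨hp.1.le, hp.2.trans hs.2⟩]

lemma intervalIntegrable_mul (hZ : IsContinuousProcessOn Z t)
    (hw : IntervalIntegrable w volume 0 t) (hs : s ∈ Icc 0 t) (ω : Ω) :
    IntervalIntegrable (fun r => w r * Z r ω) volume 0 s :=
  (hw.mono_Icc ⟨le_rfl, hs.1.trans hs.2⟩ hs).mul_continuousOn
    ((hZ.continuousOn ω).mono (by rw [uIcc_of_le hs.1]; exact Icc_subset_Icc_right hs.2))

/-- The process `∫_0^s w(r) Z_r dr` is again a continuous process. -/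
lemma integral_mul (hZ : IsContinuousProcessOn Z t) (hw : IntervalIntegrable w volume 0 t) :
    IsContinuousProcessOn (fun s ω => ∫ r in (0 : ℝ)..s, w r * Z r ω) t := by
  refine ⟨fun s hs => ?_, fun ω => ?_⟩
  · have hw' := ((intervalIntegrable_iff_integrableOn_Ioc_of_le hs.1).1
      (hw.mono_Icc ⟨le_rfl, hs.1.trans hs.2⟩ hs)).aestronglyMeasurable
    have heq : ∀ ω, ∫ r in (0 : ℝ)..s, w r * Z r ω = ∫ r, hw'.mk w r *
        Z (projIcc 0 t (hs.1.trans hs.2) r) ω ∂(volume.restrict (Ioc 0 s)) := by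
      intro ω
      rw [intervalIntegral.integral_of_le hs.1]
      refine integral_congr_ae ?_
      filter_upwards [hw'.ae_eq_mk, ae_restrict_mem measurableSet_Ioc] with r hr1 hr2
      rw [hr1, projIcc_of_mem (hs.1.trans hs.2) ⟨hr2.1.le, hr2.2.trans hs.2⟩]
    simp only [heq]
    refine StronglyMeasurable.measurable (StronglyMeasurable.integral_prod_left'
      (f := fun p : ℝ × Ω => hw'.mk w p.1 * Z (projIcc 0 t (hs.1.trans hs.2) p.1) p.2) ?_)
    exact ((hw'.stronglyMeasurable_mk.measurable.comp measurable_fst).mul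
      (hZ.measurable_projIcc _)).stronglyMeasurable
  · rcases lt_or_ge t 0 with ht | ht
    · simp [Icc_eq_empty_of_lt ht]
    · exact IsPrimitiveOn.continuousOn (f := fun r => w r * Z r ω)
        ⟨ht, hZ.intervalIntegrable_mul hw ⟨ht, le_rfl⟩ ω, fun s _ => by simp⟩

lemma sub {Z' : ℝ → Ω → ℝ} (hZ : IsContinuousProcessOn Z t) (hZ' : IsContinuousProcessOn Z' t) :
    IsContinuousProcessOn (fun r ω => Z r ω - Z' r ω) t :=
  ⟨fun r hr => (hZ.measurable r hr).sub (hZ'.measurable r hr),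
    fun ω => (hZ.continuousOn ω).sub (hZ'.continuousOn ω)⟩

lemma sum {ι : Type*} (S : Finset ι) {Z : ι → ℝ → Ω → ℝ}
    (hZ : ∀ i ∈ S, IsContinuousProcessOn (Z i) t) :
    IsContinuousProcessOn (fun r ω => ∑ i ∈ S, Z i r ω) t :=
  ⟨fun r hr => Finset.measurable_sum _ fun i hi => (hZ i hi).measurable r hr,
    fun ω => continuousOn_finsetSum _ fun i hi => (hZ i hi).continuousOn ω⟩

lemma congr {Z' : ℝ → Ω → ℝ} (hZ : IsContinuousProcessOn Z t)
    (h : ∀ r ∈ Icc 0 t, ∀ ω, Z' r ω = Z r ω) : IsContinuousProcessOn Z' t :=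
  ⟨fun r hr => by rw [funext (h r hr)]; exact hZ.measurable r hr,
    fun ω => (hZ.continuousOn ω).congr fun r hr => h r hr ω⟩

variable [IsProbabilityMeasure P]

/-- The integrability behind Fubini's theorem for `∫_0^s w(r) E[Z_r Y] dr`. -/
lemma integrable_prod (hZ : IsContinuousProcessOn Z t) (hZL : ∀ r ∈ Icc 0 t, MemLp (Z r) 2 P)
    (hZM : ∀ r ∈ Icc 0 t, ∫ ω, Z r ω ^ 2 ∂P ≤ M) (hw : IntervalIntegrable w volume 0 t)
    (hs : s ∈ Icc 0 t) (hY : MemLp Y 2 P) :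
    Integrable (fun p : ℝ × Ω => w p.1 * Z p.1 p.2 * Y p.2)
      ((volume.restrict (Ioc 0 s)).prod P) := by
  have hw' : Integrable w (volume.restrict (Ioc 0 s)) :=
    (intervalIntegrable_iff_integrableOn_Ioc_of_le hs.1).1
      (hw.mono_Icc ⟨le_rfl, hs.1.trans hs.2⟩ hs)
  have hmeas : AEStronglyMeasurable (fun p : ℝ × Ω => w p.1 * Z p.1 p.2 * Y p.2)
      ((volume.restrict (Ioc 0 s)).prod P) :=
    (hw'.aestronglyMeasurable.comp_fst.mul (hZ.aestronglyMeasurable_prod hs)).mul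
      hY.aestronglyMeasurable.comp_snd
  have hmem : ∀ᵐ r ∂(volume.restrict (Ioc 0 s)), r ∈ Icc 0 t := by
    filter_upwards [ae_restrict_mem measurableSet_Ioc] with r hr
    exact ⟨hr.1.le, hr.2.trans hs.2⟩
  refine (integrable_prod_iff hmeas).2 ⟨?_, ?_⟩
  · filter_upwards [hmem] with r hr
    simp only [mul_assoc]
    exact ((hZL r hr).integrable_mul hY).const_mul _
  · refine (hw'.norm.mul_const (M + ∫ ω, Y ω ^ 2 ∂P)).mono'
      hmeas.norm.integral_prod_right' ?_
    filter_upwards [hmem] with r hr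
    rw [Real.norm_of_nonneg (integral_nonneg fun _ => norm_nonneg _)]
    have hZY : Integrable (fun ω => Z r ω * Y ω) P := (hZL r hr).integrable_mul hY
    have hle : ∫ ω, ‖Z r ω * Y ω‖ ∂P ≤ M + ∫ ω, Y ω ^ 2 ∂P := by
      calc ∫ ω, ‖Z r ω * Y ω‖ ∂P ≤ ∫ ω, (Z r ω ^ 2 + Y ω ^ 2) ∂P := by
            refine integral_mono hZY.norm ((hZL r hr).integrable_sq.add hY.integrable_sq)
              fun ω => ?_
            simp only [Real.norm_eq_abs]
            rw [abs_le]
            constructor <;> nlinarith [sq_nonneg (Z r ω + Y ω), sq_nonneg (Z r ω - Y ω)]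
        _ = ∫ ω, Z r ω ^ 2 ∂P + ∫ ω, Y ω ^ 2 ∂P :=
            integral_add (hZL r hr).integrable_sq hY.integrable_sq
        _ ≤ _ := by gcongr; exact hZM r hr
    calc ∫ ω, ‖w r * Z r ω * Y ω‖ ∂P = ‖w r‖ * ∫ ω, ‖Z r ω * Y ω‖ ∂P := by
          rw [← integral_const_mul]
          exact integral_congr_ae (Eventually.of_forall fun ω => by simp [mul_assoc])
      _ ≤ _ := mul_le_mul_of_nonneg_left hle (norm_nonneg _)

/-- Cauchy-Schwarz: `∫_0^s w(r) Z_r dr` is square integrable. -/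
lemma memLp_integral (hZ : IsContinuousProcessOn Z t) (hZL : ∀ r ∈ Icc 0 t, MemLp (Z r) 2 P)
    (hZM : ∀ r ∈ Icc 0 t, ∫ ω, Z r ω ^ 2 ∂P ≤ M) (hw : IntervalIntegrable w volume 0 t)
    (hs : s ∈ Icc 0 t) : MemLp (fun ω => ∫ r in (0 : ℝ)..s, w r * Z r ω) 2 P := by
  have hmeas : AEStronglyMeasurable (fun ω => ∫ r in (0 : ℝ)..s, w r * Z r ω) P :=
    ((hZ.integral_mul hw).measurable s hs).aestronglyMeasurable
  refine (memLp_two_iff_integrable_sq hmeas).2 ?_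
  have ht0 : (0 : ℝ) ∈ Icc 0 t := ⟨le_rfl, hs.1.trans hs.2⟩
  set a := ∫ r in (0 : ℝ)..s, |w r| with ha
  have ha0 : 0 ≤ a := intervalIntegral.integral_nonneg hs.1 fun _ _ => abs_nonneg _
  have hsub : Icc 0 s ⊆ Icc 0 t := Icc_subset_Icc_right hs.2
  have hq : Integrable (fun ω => ∫ r in (0 : ℝ)..s, |w r| * Z r ω ^ 2) P := by
    have hw' : Integrable w (volume.restrict (Ioc 0 s)) :=
      (intervalIntegrable_iff_integrableOn_Ioc_of_le hs.1).1 (hw.mono_Icc ht0 hs)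
    have hm : AEStronglyMeasurable (fun p : ℝ × Ω => |w p.1| * Z p.1 p.2 ^ 2)
        ((volume.restrict (Ioc 0 s)).prod P) :=
      hw'.norm.aestronglyMeasurable.comp_fst.mul ((hZ.aestronglyMeasurable_prod hs).pow 2)
    have hmem : ∀ᵐ r ∂(volume.restrict (Ioc 0 s)), r ∈ Icc 0 t := by
      filter_upwards [ae_restrict_mem measurableSet_Ioc] with r hr
      exact ⟨hr.1.le, hr.2.trans hs.2⟩
    have hprod : Integrable (fun p : ℝ × Ω => |w p.1| * Z p.1 p.2 ^ 2)
        ((volume.restrict (Ioc 0 s)).prod P) := by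
      refine (integrable_prod_iff hm).2 ⟨?_, ?_⟩
      · filter_upwards [hmem] with r hr
        exact (hZL r hr).integrable_sq.const_mul _
      · refine (hw'.norm.mul_const M).mono' hm.norm.integral_prod_right' ?_
        filter_upwards [hmem] with r hr
        rw [Real.norm_of_nonneg (integral_nonneg fun _ => norm_nonneg _)]
        calc ∫ ω, ‖|w r| * Z r ω ^ 2‖ ∂P = ‖w r‖ * ∫ ω, Z r ω ^ 2 ∂P := by
              rw [← integral_const_mul]
              exact integral_congr_ae (Eventually.of_forall fun ω => by simp)
          _ ≤ _ := mul_le_mul_of_nonneg_left (hZM r hr) (norm_nonneg _)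
    simpa only [intervalIntegral.integral_of_le hs.1] using hprod.integral_prod_right
  refine (hq.const_mul ((a + 1) ^ 2)).mono' (hmeas.pow 2) (Eventually.of_forall fun ω => ?_)
  rw [Real.norm_of_nonneg (sq_nonneg _)]
  have hcZ : ContinuousOn (fun r => Z r ω) (uIcc 0 s) := by
    rw [uIcc_of_le hs.1]; exact (hZ.continuousOn ω).mono hsub
  have hwa := (hw.mono_Icc ht0 hs).abs
  have i1 : IntervalIntegrable (fun r => |w r| * |Z r ω|) volume 0 s :=
    hwa.mul_continuousOn hcZ.abs
  have i2 : IntervalIntegrable (fun r => |w r| * Z r ω ^ 2) volume 0 s :=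
    hwa.mul_continuousOn (hcZ.pow 2)
  set e := ∫ r in (0 : ℝ)..s, |w r| * |Z r ω| with he
  set q := ∫ r in (0 : ℝ)..s, |w r| * Z r ω ^ 2 with hqdef
  have hDe : |∫ r in (0 : ℝ)..s, w r * Z r ω| ≤ e := by
    refine (intervalIntegral.abs_integral_le_integral_abs hs.1).trans_eq ?_
    simp only [abs_mul, he]
  -- With `a = ∫ |w|`, `e = ∫ |w| |Z|` and `q = ∫ |w| Z²`, expanding this square gives
  -- `(a + 2) e² ≤ (a + 1)² q`; the `+ 1` avoids a division by `a = 0`.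
  have hpos : 0 ≤ ∫ r in (0 : ℝ)..s, |w r| * ((a + 1) * |Z r ω| - e) ^ 2 :=
    intervalIntegral.integral_nonneg hs.1 fun _ _ => by positivity
  have hexp : ∫ r in (0 : ℝ)..s, |w r| * ((a + 1) * |Z r ω| - e) ^ 2
      = (a + 1) ^ 2 * q - 2 * (a + 1) * e * e + e ^ 2 * a := by
    have : ∀ r, |w r| * ((a + 1) * |Z r ω| - e) ^ 2 = (a + 1) ^ 2 * (|w r| * Z r ω ^ 2)
        - 2 * (a + 1) * e * (|w r| * |Z r ω|) + e ^ 2 * |w r| := fun r => by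
      rw [← sq_abs (Z r ω)]; ring
    simp only [this]
    rw [intervalIntegral.integral_add ((i2.const_mul _).sub (i1.const_mul _)) (hwa.const_mul _),
      intervalIntegral.integral_sub (i2.const_mul _) (i1.const_mul _),
      intervalIntegral.integral_const_mul, intervalIntegral.integral_const_mul,
      intervalIntegral.integral_const_mul]
  have he2 : e ^ 2 ≤ (a + 1) ^ 2 * q := by nlinarith [sq_nonneg e]
  refine le_trans ?_ he2
  rw [← sq_abs]
  gcongr

lemma covariance_integral (hZ : IsContinuousProcessOn Z t) (hZL : ∀ r ∈ Icc 0 t, MemLp (Z r) 2 P)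
    (hZM : ∀ r ∈ Icc 0 t, ∫ ω, Z r ω ^ 2 ∂P ≤ M) (hw : IntervalIntegrable w volume 0 t)
    (hs : s ∈ Icc 0 t) (hY : MemLp Y 2 P) :
    cov[fun ω => ∫ r in (0 : ℝ)..s, w r * Z r ω, Y; P]
      = ∫ r in (0 : ℝ)..s, w r * cov[Z r, Y; P] := by
  have hswap : ∀ {y : Ω → ℝ}, MemLp y 2 P →
      ∫ ω, (∫ r in (0 : ℝ)..s, w r * Z r ω) * y ω ∂P
        = ∫ r in (0 : ℝ)..s, w r * ∫ ω, Z r ω * y ω ∂P := by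
    intro y hy
    simp only [intervalIntegral.integral_of_le hs.1, ← integral_mul_const, ← integral_const_mul,
      ← mul_assoc]
    exact (integral_integral_swap (f := fun r ω => w r * Z r ω * y ω)
      (hZ.integrable_prod hZL hZM hw hs hy)).symm
  have hint : ∀ {y : Ω → ℝ}, MemLp y 2 P →
      IntervalIntegrable (fun r => w r * ∫ ω, Z r ω * y ω ∂P) volume 0 s := by
    intro y hy
    rw [intervalIntegrable_iff_integrableOn_Ioc_of_le hs.1]
    have := (hZ.integrable_prod hZL hZM hw hs hy).integral_prod_left
    rw [IntegrableOn]
    simpa only [mul_assoc, integral_const_mul] using this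
  have h1 := hswap (y := fun _ => 1) (memLp_const 1)
  have h2 := hint (y := fun _ => 1) (memLp_const 1)
  simp only [mul_one] at h1 h2
  rw [covariance_eq_sub (hZ.memLp_integral hZL hZM hw hs) hY]
  simp only [Pi.mul_apply]
  rw [hswap hY, h1, ← intervalIntegral.integral_mul_const,
    ← intervalIntegral.integral_sub (hint hY) (h2.mul_const _)]
  refine intervalIntegral.integral_congr fun r hr => ?_
  rw [uIcc_of_le hs.1] at hr
  simp only [covariance_eq_sub (hZL r ⟨hr.1, hr.2.trans hs.2⟩) hY, Pi.mul_apply]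
  ring

end IsContinuousProcessOn

end TimeIntegral

/-! ### Variation of constants for processes -/

lemma IsMatrixPrimitiveOn.unique {p q : ℕ} {F G f : ℝ → Matrix (Fin p) (Fin q) ℝ} {u t : ℝ}
    (hF : IsMatrixPrimitiveOn F f u t) (hG : IsMatrixPrimitiveOn G f u t) (h : F u = G u) {s : ℝ}
    (hs : s ∈ Icc u t) : F s = G s := by
  ext i j
  rw [(hF i j).eq hs, (hG i j).eq hs, h]

/-- `∫_0^{min(s, v)} f` is in `s` a primitive of `f 1_{(-∞, v]}`. -/
lemma MatrixIntegrableOn.isMatrixPrimitiveOn_min {p q : ℕ} {f : ℝ → Matrix (Fin p) (Fin q) ℝ}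
    {t v : ℝ} (ht : 0 ≤ t) (hf : MatrixIntegrableOn f 0 t) (hv : v ∈ Icc 0 t)
    (S : Matrix (Fin p) (Fin q) ℝ) :
    IsMatrixPrimitiveOn (fun s => S + matrixIntegral f 0 (min s v)) ((Iic v).indicator f) 0 t := by
  have hentry : ∀ i j, (fun r => (Iic v).indicator f r i j)
      = (Iic v).indicator fun r => f r i j := fun i j => by
    ext r
    by_cases hr : r ∈ Iic v <;> simp [hr]
  have hint : MatrixIntegrableOn ((Iic v).indicator f) 0 t := fun i j => by
    rw [hentry]
    have := hf i j
    rw [intervalIntegrable_iff_integrableOn_Ioc_of_le ht] at this ⊢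
    exact this.indicator measurableSet_Iic
  refine IsMatrixPrimitiveOn.of_matrixIntegral ht hint S fun s hs => ?_
  congr 1
  ext i j
  simp only [matrixIntegral, Matrix.of_apply]
  rw [hentry]
  rcases le_total s v with hsv | hvs
  · rw [min_eq_left hsv]
    refine intervalIntegral.integral_congr fun r hr => ?_
    rw [uIcc_of_le hs.1] at hr
    simp [hr.2.trans hsv]
  · rw [min_eq_right hvs]
    exact (intervalIntegral.integral_indicator ⟨hv.1, hvs⟩).symm

section CovMatrix

variable {Ω : Type*} [MeasurableSpace Ω] {P : Measure Ω} {p q k : ℕ}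

lemma covMatrix_transpose (X : Ω → Fin p → ℝ) (Y : Ω → Fin q → ℝ) :
    (covMatrix P X Y)ᵀ = covMatrix P Y X := by
  ext i j
  exact covariance_comm _ _

lemma covMatrix_congr {X X' : Ω → Fin p → ℝ} {Y Y' : Ω → Fin q → ℝ} (hX : X =ᵐ[P] X')
    (hY : Y =ᵐ[P] Y') : covMatrix P X Y = covMatrix P X' Y' := by
  ext i j
  have hi : (fun ω => X ω i) =ᵐ[P] fun ω => X' ω i := hX.mono fun ω h => congrFun h i
  have hj : (fun ω => Y ω j) =ᵐ[P] fun ω => Y' ω j := hY.mono fun ω h => congrFun h j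
  simp only [covMatrix, Matrix.of_apply, covariance, integral_congr_ae hi, integral_congr_ae hj]
  refine integral_congr_ae ?_
  filter_upwards [hi, hj] with ω h1 h2
  rw [h1, h2]

lemma memLp_mulVec (M : Matrix (Fin k) (Fin p) ℝ) {X : Ω → Fin p → ℝ}
    (hX : ∀ i, MemLp (fun ω => X ω i) 2 P) (i : Fin k) :
    MemLp (fun ω => (M *ᵥ X ω) i) 2 P := by
  simp only [Matrix.mulVec, dotProduct]
  exact memLp_finsetSum _ fun l _ => (hX l).const_mul (M i l)

variable [IsFiniteMeasure P]

lemma covMatrix_mulVec_left (M : Matrix (Fin k) (Fin p) ℝ) {X : Ω → Fin p → ℝ}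
    {Y : Ω → Fin q → ℝ} (hX : ∀ i, MemLp (fun ω => X ω i) 2 P)
    (hY : ∀ j, MemLp (fun ω => Y ω j) 2 P) :
    covMatrix P (fun ω => M *ᵥ X ω) Y = M * covMatrix P X Y := by
  ext i j
  simp only [covMatrix, Matrix.of_apply, Matrix.mul_apply, Matrix.mulVec, dotProduct]
  rw [covariance_fun_sum_left (fun l => (hX l).const_mul (M i l)) (hY j)]
  simp only [covariance_const_mul_left]

lemma covMatrix_mulVec_right (M : Matrix (Fin k) (Fin q) ℝ) {X : Ω → Fin p → ℝ}
    {Y : Ω → Fin q → ℝ} (hX : ∀ i, MemLp (fun ω => X ω i) 2 P)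
    (hY : ∀ j, MemLp (fun ω => Y ω j) 2 P) :
    covMatrix P X (fun ω => M *ᵥ Y ω) = covMatrix P X Y * Mᵀ := by
  rw [← covMatrix_transpose, covMatrix_mulVec_left M hY hX, Matrix.transpose_mul,
    covMatrix_transpose]

end CovMatrix

/-- The integral `∫_0^s Ψ dZ` of a matrix function `Ψ` with `Ψ' = -Ψ A` against a process `Z`,
defined by partial integration as `Ψ(s) Z_s + ∫_0^s Ψ(r) A(r) Z_r dr`. -/
noncomputable def partialIntegral {Ω : Type*} {d : ℕ} (A Ψ : ℝ → Matrix (Fin d) (Fin d) ℝ)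
    (Z : ℝ → Ω → Fin d → ℝ) (s : ℝ) (ω : Ω) : Fin d → ℝ :=
  fun i => (Ψ s *ᵥ Z s ω) i + ∫ r in (0 : ℝ)..s, ((Ψ r * A r) *ᵥ Z r ω) i

section PartialIntegral

variable {Ω : Type*} [MeasurableSpace Ω] {P : Measure Ω}
  {d p : ℕ} {t : ℝ} {A Ψ : ℝ → Matrix (Fin d) (Fin d) ℝ} {Z : ℝ → Ω → Fin d → ℝ}

lemma integral_mulVec_eq_sum {w : ℝ → Matrix (Fin d) (Fin d) ℝ} (hw : MatrixIntegrableOn w 0 t)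
    (hZ : ∀ i, IsContinuousProcessOn (fun r ω => Z r ω i) t) {s : ℝ} (hs : s ∈ Icc 0 t) (ω : Ω)
    (i : Fin d) : ∫ r in (0 : ℝ)..s, (w r *ᵥ Z r ω) i
      = ∑ l, ∫ r in (0 : ℝ)..s, w r i l * Z r ω l := by
  simp only [Matrix.mulVec, dotProduct]
  exact intervalIntegral.integral_finsetSum fun l _ =>
    (hZ l).intervalIntegrable_mul (hw i l) hs ω

/-- A solution of a linear equation is recovered from its driving process: if
`Z_s = X_s - ∫_0^s A X dr`, then `Ψ X = ∫ Ψ dZ`. -/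
lemma partialIntegral_sub_integral {X : ℝ → Ω → Fin d → ℝ} (ht : 0 ≤ t)
    (hA : MatrixIntegrableOn A 0 t)
    (hΨ : IsMatrixPrimitiveOn Ψ (fun r => -(Ψ r * A r)) 0 t)
    (hX : ∀ i, IsContinuousProcessOn (fun r ω => X r ω i) t) {s : ℝ} (hs : s ∈ Icc 0 t) (ω : Ω) :
    partialIntegral A Ψ (fun s ω i => X s ω i - ∫ r in (0 : ℝ)..s, (A r *ᵥ X r ω) i) s ω
      = Ψ s *ᵥ X s ω := by
  set η : ℝ → Fin d → ℝ := fun s i => ∫ r in (0 : ℝ)..s, (A r *ᵥ X r ω) i with hη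
  have hηp : ∀ i, IsPrimitiveOn (fun s => η s i) (fun r => (A r *ᵥ X r ω) i) 0 t := by
    intro i
    refine ⟨ht, ?_, fun s _ => by simp [hη]⟩
    have := IntervalIntegrable.sum Finset.univ fun l (_ : l ∈ Finset.univ) =>
      (hX l).intervalIntegrable_mul (hA i l) ⟨ht, le_rfl⟩ ω
    exact this.congr fun r _ => by simp [Matrix.mulVec, dotProduct]
  ext i
  have hp : IsPrimitiveOn (fun s => (Ψ s *ᵥ η s) i)
      (fun r => ((Ψ r * A r) *ᵥ (fun j => X r ω j - η r j)) i) 0 t := by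
    refine (IsPrimitiveOn.sum ht Finset.univ fun l _ => (hΨ i l).mul (hηp l)).congr
      (fun s _ => rfl) fun r _ => ?_
    have h1 : ((Ψ r * A r) *ᵥ (fun j => X r ω j - η r j)) i
        = (Ψ r *ᵥ (A r *ᵥ X r ω)) i - ((Ψ r * A r) *ᵥ η r) i := by
      rw [Matrix.mulVec_mulVec, ← Pi.sub_apply, ← Matrix.mulVec_sub]
      rfl
    rw [h1, Finset.sum_add_distrib]
    simp only [Matrix.neg_apply, neg_mul, Finset.sum_neg_distrib]
    rw [neg_add_eq_sub]
    rfl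
  have h := hp.eq hs
  have h0 : η 0 = 0 := by ext i; simp [hη]
  simp only [h0, Matrix.mulVec_zero, Pi.zero_apply, zero_add] at h
  have h2 : (Ψ s *ᵥ fun j => X s ω j - η s j) i = (Ψ s *ᵥ X s ω) i - (Ψ s *ᵥ η s) i := by
    rw [← Pi.sub_apply, ← Matrix.mulVec_sub]
    rfl
  change (Ψ s *ᵥ fun j => X s ω j - η s j) i + ∫ r in (0 : ℝ)..s,
    ((Ψ r * A r) *ᵥ fun j => X r ω j - η r j) i = _
  rw [← h, h2, sub_add_cancel]

variable [IsProbabilityMeasure P]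

lemma memLp_partialIntegral (ht : 0 ≤ t) (hA : MatrixIntegrableOn A 0 t)
    (hΨ : ContinuousOn Ψ (Icc 0 t)) (hZ : ∀ i, IsContinuousProcessOn (fun r ω => Z r ω i) t)
    (hZL : ∀ r ∈ Icc 0 t, ∀ i, MemLp (fun ω => Z r ω i) 2 P)
    (hZM : ∀ i, ∃ M, ∀ r ∈ Icc 0 t, ∫ ω, Z r ω i ^ 2 ∂P ≤ M) {s : ℝ} (hs : s ∈ Icc 0 t)
    (i : Fin d) : MemLp (fun ω => partialIntegral A Ψ Z s ω i) 2 P := by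
  have hΨA := hA.continuousOn_mul ht hΨ
  refine (memLp_mulVec (Ψ s) (hZL s hs) i).add ?_
  simp only [integral_mulVec_eq_sum hΨA hZ hs]
  exact memLp_finsetSum _ fun l _ => by
    obtain ⟨M, hM⟩ := hZM l
    exact (hZ l).memLp_integral (fun r hr => hZL r hr l) hM (hΨA i l) hs

/-- If `cov(Z_r, W) = S + ∫_0^{min(r, v)} g`, then `cov(∫_0^s Ψ dZ, W) = S + ∫_0^{min(s, v)} Ψ g`:
partial integration undoes the one in the definition of `∫ Ψ dZ`. -/
lemma covMatrix_partialIntegral (ht : 0 ≤ t) (hA : MatrixIntegrableOn A 0 t)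
    (hΨ : IsMatrixPrimitiveOn Ψ (fun r => -(Ψ r * A r)) 0 t) (hΨ0 : Ψ 0 = 1)
    (hZ : ∀ i, IsContinuousProcessOn (fun r ω => Z r ω i) t)
    (hZL : ∀ r ∈ Icc 0 t, ∀ i, MemLp (fun ω => Z r ω i) 2 P)
    (hZM : ∀ i, ∃ M, ∀ r ∈ Icc 0 t, ∫ ω, Z r ω i ^ 2 ∂P ≤ M)
    {W : Ω → Fin p → ℝ} (hW : ∀ j, MemLp (fun ω => W ω j) 2 P)
    {g : ℝ → Matrix (Fin d) (Fin p) ℝ} (hg : MatrixIntegrableOn g 0 t)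
    {S : Matrix (Fin d) (Fin p) ℝ} {v : ℝ} (hv : v ∈ Icc 0 t)
    (hcov : ∀ r ∈ Icc 0 t, covMatrix P (Z r) W = S + matrixIntegral g 0 (min r v))
    {s : ℝ} (hs : s ∈ Icc 0 t) :
    covMatrix P (partialIntegral A Ψ Z s) W
      = S + matrixIntegral (fun r => Ψ r * g r) 0 (min s v) := by
  have h0 : (0 : ℝ) ∈ Icc 0 t := ⟨le_rfl, ht⟩
  have hK := (hg.isMatrixPrimitiveOn_min ht hv S).congr hcov fun _ _ => rfl
  have hΨA := hA.continuousOn_mul ht hΨ.continuousOn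
  have hΨAK := hΨA.mul_continuousOn ht hK.continuousOn
  have hY : ∀ s ∈ Icc 0 t, covMatrix P (partialIntegral A Ψ Z s) W
      = Ψ s * covMatrix P (Z s) W
        + (0 + matrixIntegral (fun r => Ψ r * A r * covMatrix P (Z r) W) 0 s) := by
    intro s hs
    have hmem : ∀ i l, MemLp (fun ω => ∫ r in (0 : ℝ)..s, (Ψ r * A r) i l * Z r ω l) 2 P := by
      intro i l
      obtain ⟨M, hM⟩ := hZM l
      exact (hZ l).memLp_integral (fun r hr => hZL r hr l) hM (hΨA i l) hs
    rw [zero_add, ← covMatrix_mulVec_left (Ψ s) (hZL s hs) hW]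
    ext i j
    simp only [covMatrix, partialIntegral, Matrix.add_apply, Matrix.of_apply, matrixIntegral,
      Matrix.mul_apply (M := Ψ _ * A _)]
    simp only [integral_mulVec_eq_sum hΨA hZ hs]
    change cov[(fun ω => (Ψ s *ᵥ Z s ω) i) +
      (fun ω => ∑ l, ∫ r in (0 : ℝ)..s, (Ψ r * A r) i l * Z r ω l), _; P] = _
    rw [covariance_add_left (memLp_mulVec _ (hZL s hs) i)
      (memLp_finsetSum _ fun l _ => hmem i l) (hW j),
      covariance_fun_sum_left (fun l => hmem i l) (hW j),
      intervalIntegral.integral_finsetSum fun l _ => ?_]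
    · congr 1
      refine Finset.sum_congr rfl fun l _ => ?_
      obtain ⟨M, hM⟩ := hZM l
      exact (hZ l).covariance_integral (fun r hr => hZL r hr l) hM (hΨA i l) hs (hW j)
    · refine ((hΨA i l).mul_continuousOn ?_).mono_Icc h0 hs
      rw [uIcc_of_le ht]
      exact continuousOn_matrix_iff.1 hK.continuousOn l j
  have hprim : IsMatrixPrimitiveOn (fun s => covMatrix P (partialIntegral A Ψ Z s) W)
      ((Iic v).indicator fun r => Ψ r * g r) 0 t := by
    refine ((hΨ.mul ht hK).add (IsMatrixPrimitiveOn.of_matrixIntegral ht hΨAK 0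
      fun s _ => rfl)).congr hY fun r _ => ?_
    by_cases hr : r ∈ Iic v
    · simp only [indicator_of_mem hr, Matrix.neg_mul]
      abel
    · simp only [indicator_of_notMem hr, Matrix.neg_mul, Matrix.mul_zero]
      abel
  have hΨg := hg.continuousOn_mul ht hΨ.continuousOn
  refine hprim.unique (hΨg.isMatrixPrimitiveOn_min ht hv S) ?_ hs
  have hz : ∀ {q : ℕ} (f : ℝ → Matrix (Fin d) (Fin q) ℝ), matrixIntegral f 0 0 = 0 := fun f => by
    ext i j
    simp [matrixIntegral]
  rw [hY 0 h0, hcov 0 h0, min_eq_left hv.1, hz, hz, hz, hΨ0, Matrix.one_mul, add_zero,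
    add_zero, add_zero]

/-- The covariances of `∫ Ψ dZ`, where `Z` has the covariances of a process with independent
increments. -/
theorem covMatrix_partialIntegral_partialIntegral (ht : 0 ≤ t) (hA : MatrixIntegrableOn A 0 t)
    (hΨ : IsMatrixPrimitiveOn Ψ (fun r => -(Ψ r * A r)) 0 t) (hΨ0 : Ψ 0 = 1)
    (hZ : ∀ i, IsContinuousProcessOn (fun r ω => Z r ω i) t)
    (hZL : ∀ r ∈ Icc 0 t, ∀ i, MemLp (fun ω => Z r ω i) 2 P)
    (hZM : ∀ i, ∃ M, ∀ r ∈ Icc 0 t, ∫ ω, Z r ω i ^ 2 ∂P ≤ M)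
    {β : ℝ → Matrix (Fin d) (Fin d) ℝ} (hβ : MatrixIntegrableOn β 0 t)
    (hβT : ∀ r, (β r)ᵀ = β r) {S : Matrix (Fin d) (Fin d) ℝ} (hST : Sᵀ = S)
    (hcov : ∀ s ∈ Icc 0 t, ∀ v ∈ Icc 0 t,
      covMatrix P (Z s) (Z v) = S + matrixIntegral β 0 (min s v))
    {s v : ℝ} (hs : s ∈ Icc 0 t) (hv : v ∈ Icc 0 t) :
    covMatrix P (partialIntegral A Ψ Z s) (partialIntegral A Ψ Z v)
      = S + matrixIntegral (fun r => Ψ r * β r * (Ψ r)ᵀ) 0 (min s v) := by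
  have hΨT : ContinuousOn (fun r => (Ψ r)ᵀ) (Icc 0 t) := hΨ.transpose.continuousOn
  have h1 : ∀ r ∈ Icc 0 t, covMatrix P (Z r) (partialIntegral A Ψ Z v)
      = S + matrixIntegral (fun r => β r * (Ψ r)ᵀ) 0 (min r v) := by
    intro r hr
    have h := covMatrix_partialIntegral ht hA hΨ hΨ0 hZ hZL hZM (hZL r hr) hβ hr
      (fun q hq => hcov q hq r hr) hv
    rw [← covMatrix_transpose, h, Matrix.transpose_add, hST, min_comm]
    congr 1
    ext i j
    simp only [matrixIntegral, Matrix.transpose_apply, Matrix.of_apply]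
    refine intervalIntegral.integral_congr fun q _ => ?_
    rw [← Matrix.transpose_apply (Ψ q * β q), Matrix.transpose_mul, hβT]
  have h := covMatrix_partialIntegral ht hA hΨ hΨ0 hZ hZL hZM
    (memLp_partialIntegral ht hA hΨ.continuousOn hZ hZL hZM hv) (hβ.mul_continuousOn ht hΨT) hv
    h1 hs
  simpa only [Matrix.mul_assoc] using h

end PartialIntegral

/-! ### Covariances of solutions of linear stochastic differential equations -/

section SDE

variable {Ω : Type*} [MeasurableSpace Ω] {P : Measure Ω}
  {d m : ℕ} {t : ℝ} {A : ℝ → Matrix (Fin d) (Fin d) ℝ} {b : ℝ → Matrix (Fin d) (Fin m) ℝ}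
  {V : Fin m → ℝ≥0 → Ω → ℝ} {ξ : ℝ → Ω → Fin d → ℝ}

/-- A modification of the solution, off a null set on which it is set to zero, has only continuous
paths. -/
lemma IsLinearSDESolution.exists_modification (hξ : IsLinearSDESolution P A b V t ξ) :
    ∃ X : ℝ → Ω → Fin d → ℝ, (∀ i, IsContinuousProcessOn (fun r ω => X r ω i) t) ∧
      ∀ᵐ ω ∂P, ∀ r, X r ω = ξ r ω := by
  classical
  set N := toMeasurable P {ω | ¬ContinuousOn (fun s => ξ s ω) (Icc 0 t)} with hN
  have hN0 : P N = 0 := by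
    rw [hN, measure_toMeasurable]
    exact hξ.continuous_paths
  refine ⟨fun r ω => if ω ∈ N then 0 else ξ r ω, fun i => ⟨fun r hr => ?_, fun ω => ?_⟩, ?_⟩
  · exact (measurable_pi_apply i).comp
      (Measurable.ite (measurableSet_toMeasurable _ _) measurable_const (hξ.measurable r hr))
  · by_cases hω : ω ∈ N
    · simpa [hω] using continuousOn_const
    · simp only [hω, if_false]
      have : ContinuousOn (fun s => ξ s ω) (Icc 0 t) := by
        by_contra hcon
        exact hω (subset_toMeasurable P _ hcon)
      exact continuousOn_pi.1 this i
  · filter_upwards [measure_eq_zero_iff_ae_notMem.1 hN0] with ω hω r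
    simp [hω]

variable [IsProbabilityMeasure P]

/-- The covariances of `ζ + ∫_0^s b dV` for an initial value `ζ` independent of `V`: by the Itô
isometry and independence, they are `cov(ζ, ζ) + ∫_0^{min(s, v)} b bᵀ`. -/
lemma covariance_initial_add_noise (hbm : ∀ i k, Measurable fun r => b r i k)
    (hb : ∀ i k, IntervalIntegrable (fun r => b r i k ^ 2) volume 0 t)
    (hV : IsBrownianVector P V) {ζ : Ω → Fin d → ℝ} (hζ : ∀ i, MemLp (fun ω => ζ ω i) 2 P)
    (hind : IndepFun ζ (fun ω k r => V k r ω) P) {s v : ℝ≥0} (hs : (s : ℝ) ≤ t) (hv : (v : ℝ) ≤ t)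
    {i j : Fin d} {J K : Fin m → Ω → ℝ}
    (hJ : ∀ k, IsWienerIntegral P (V k) (fun r => b r i k) s (J k))
    (hK : ∀ k, IsWienerIntegral P (V k) (fun r => b r j k) v (K k)) :
    cov[fun ω => ζ ω i + ∑ k, J k ω, fun ω => ζ ω j + ∑ k, K k ω; P]
      = cov[fun ω => ζ ω i, fun ω => ζ ω j; P]
        + matrixIntegral (fun r => b r * (b r)ᵀ) 0 (min (s : ℝ) v) i j := by
  have ht : 0 ≤ t := s.coe_nonneg.trans hs
  have hL : ∀ (w : ℝ≥0), (w : ℝ) ≤ t → ∀ i k,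
      MemLp (fun r => b r i k) 2 (volume.restrict (Ioc 0 (w : ℝ))) := fun w hw i k => by
    refine (memLp_two_iff_integrable_sq (hbm i k).aestronglyMeasurable).2 ?_
    exact (intervalIntegrable_iff_integrableOn_Ioc_of_le w.coe_nonneg).1
      ((hb i k).mono_Icc ⟨le_rfl, ht⟩ ⟨w.coe_nonneg, hw⟩)
  have hindk : ∀ k l, IndepFun (fun ω r => V k r ω) (fun ω => ζ ω l) P := fun k l =>
    (hind.comp (measurable_pi_apply l) (measurable_pi_apply k)).symm
  have hpre : ∀ k, IsPreBrownianReal (V k) P := fun k => (hV.isBrownian k).toIsPreBrownianReal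
  have hJs : MemLp (fun ω => ∑ k, J k ω) 2 P := memLp_finsetSum _ fun k _ => (hJ k).1
  have hKs : MemLp (fun ω => ∑ k, K k ω) 2 P := memLp_finsetSum _ fun k _ => (hK k).1
  have h1 : cov[fun ω => ∑ k, J k ω, fun ω => ζ ω j; P] = 0 := by
    rw [covariance_fun_sum_left (fun k => (hJ k).1) (hζ j)]
    exact Finset.sum_eq_zero fun k _ =>
      (hJ k).covariance_eq_zero_of_indepFun (hpre k) (hζ j) (hindk k j)
  have h2 : cov[fun ω => ζ ω i, fun ω => ∑ k, K k ω; P] = 0 := by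
    rw [covariance_comm, covariance_fun_sum_left (fun k => (hK k).1) (hζ i)]
    exact Finset.sum_eq_zero fun k _ =>
      (hK k).covariance_eq_zero_of_indepFun (hpre k) (hζ i) (hindk k i)
  have h3 : cov[fun ω => ∑ k, J k ω, fun ω => ∑ k, K k ω; P]
      = matrixIntegral (fun r => b r * (b r)ᵀ) 0 (min (s : ℝ) v) i j := by
    rw [covariance_fun_sum_fun_sum (fun k => (hJ k).1) (fun k => (hK k).1)]
    have hdiag : ∀ k, ∑ l, cov[J k, K l; P]
        = ∫ r in (0 : ℝ)..min (s : ℝ) v, b r i k * b r j k := by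
      intro k
      rw [Finset.sum_eq_single k (fun l _ hlk => ?_) (fun h => absurd (Finset.mem_univ k) h)]
      · exact (hJ k).covariance_eq (hpre k) (hK k) (hL s hs i k) (hL v hv j k)
      · exact (hJ k).covariance_eq_zero_of_indepFun_path (hpre k) (hpre l) (hK l)
          (hV.indep.indepFun hlk.symm)
    simp only [hdiag, matrixIntegral, Matrix.of_apply, Matrix.mul_apply, Matrix.transpose_apply]
    refine (intervalIntegral.integral_finsetSum fun k _ => ?_).symm
    exact (IntervalIntegrable.mul_of_sq (hbm i k) (hbm j k) (hb i k) (hb j k)).mono_Icc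
      ⟨le_rfl, ht⟩ ⟨le_min s.coe_nonneg v.coe_nonneg, (min_le_left _ _).trans hs⟩
  change cov[(fun ω => ζ ω i) + (fun ω => ∑ k, J k ω),
    (fun ω => ζ ω j) + fun ω => ∑ k, K k ω; P] = _
  rw [covariance_add_left (hζ i) hJs ((hζ j).add hKs), covariance_add_right (hζ i) (hζ j) hKs,
    covariance_add_right hJs (hζ j) hKs, h1, h2, h3]
  ring

/-- The second moments of a solution of `dξ = A ξ ds + b dV` whose initial value is centered,
square integrable and independent of the noise, in terms of a fundamental matrix `Φ` of `x' = A x`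
with inverse `Ψ`. Here `ξ = Φ ∫ Ψ dZ`, where `Z = ξ₀ + ∫ b dV`. -/
theorem IsLinearSDESolution.memLp_and_covMatrix_eq (ht : 0 ≤ t) (hA : MatrixIntegrableOn A 0 t)
    (hbm : ∀ i k, Measurable fun r => b r i k)
    (hb : ∀ i k, IntervalIntegrable (fun r => b r i k ^ 2) volume 0 t)
    (hV : IsBrownianVector P V) (hξ : IsLinearSDESolution P A b V t ξ)
    (hξ0 : ∀ i, MemLp (fun ω => ξ 0 ω i) 2 P) (hmean : ∀ i, ∫ ω, ξ 0 ω i ∂P = 0)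
    (hind : IndepFun (ξ 0) (fun ω k r => V k r ω) P)
    {Φ Ψ : ℝ → Matrix (Fin d) (Fin d) ℝ}
    (hΨ : IsMatrixPrimitiveOn Ψ (fun r => -(Ψ r * A r)) 0 t) (hΨ0 : Ψ 0 = 1)
    (hΦΨ : ∀ s ∈ Icc 0 t, Φ s * Ψ s = 1) :
    (∀ s ∈ Icc 0 t, ∀ i, MemLp (fun ω => ξ s ω i) 2 P) ∧
      ∀ s ∈ Icc 0 t, ∀ v ∈ Icc 0 t, covMatrix P (ξ s) (ξ v)
        = Φ s * (covMatrix P (ξ 0) (ξ 0)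
            + matrixIntegral (fun r => Ψ r * (b r * (b r)ᵀ) * (Ψ r)ᵀ) 0 (min s v)) * (Φ v)ᵀ := by
  obtain ⟨X, hX, hXξ⟩ := hξ.exists_modification
  have hβ : MatrixIntegrableOn (fun r => b r * (b r)ᵀ) 0 t := fun i j => by
    have := IntervalIntegrable.sum Finset.univ fun k (_ : k ∈ Finset.univ) =>
      IntervalIntegrable.mul_of_sq (hbm i k) (hbm j k) (hb i k) (hb j k)
    exact this.congr fun r _ => by simp [Matrix.mul_apply]
  -- The driving process, defined path by path so that it is continuous in time; at each time it
  -- agrees almost surely with `ξ₀ + ∫ b dV`.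
  set Z : ℝ → Ω → Fin d → ℝ := fun s ω i =>
    X s ω i - ∫ r in (0 : ℝ)..s, (A r *ᵥ X r ω) i with hZdef
  have hZ : ∀ i, IsContinuousProcessOn (fun r ω => Z r ω i) t := fun i => by
    refine (hX i).sub ?_
    exact (IsContinuousProcessOn.sum Finset.univ fun l _ => (hX l).integral_mul (hA i l)).congr
      fun s hs ω => integral_mulVec_eq_sum hA hX hs ω i
  have hpre : ∀ k, IsPreBrownianReal (V k) P := fun k => (hV.isBrownian k).toIsPreBrownianReal
  have hrep : ∀ s ∈ Icc 0 t, ∀ i, ∃ J : Fin m → Ω → ℝ,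
      (∀ k, IsWienerIntegral P (V k) (fun r => b r i k) s.toNNReal (J k)) ∧
      (fun ω => Z s ω i) =ᵐ[P] fun ω => ξ 0 ω i + ∑ k, J k ω := by
    intro s hs i
    have hs' : (s.toNNReal : ℝ) = s := Real.coe_toNNReal s hs.1
    obtain ⟨J, hJ, hJeq⟩ := hξ.equation s.toNNReal (hs'.trans_le hs.2) i
    refine ⟨J, hJ, ?_⟩
    filter_upwards [hJeq, hXξ] with ω h1 h2
    simp only [hZdef, h2]
    rw [hs'] at h1
    rw [h1]
    ring
  have hZL : ∀ r ∈ Icc 0 t, ∀ i, MemLp (fun ω => Z r ω i) 2 P := by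
    intro r hr i
    obtain ⟨J, hJ, hJeq⟩ := hrep r hr i
    exact (memLp_congr_ae hJeq).2 ((hξ0 i).add (memLp_finsetSum _ fun k _ => (hJ k).1))
  have hZmean : ∀ r ∈ Icc 0 t, ∀ i, ∫ ω, Z r ω i ∂P = 0 := by
    intro r hr i
    obtain ⟨J, hJ, hJeq⟩ := hrep r hr i
    have hJi : ∀ k, Integrable (J k) P := fun k => (hJ k).1.integrable one_le_two
    rw [integral_congr_ae hJeq, integral_add ((hξ0 i).integrable one_le_two)
      (integrable_finsetSum _ fun k _ => hJi k), hmean, integral_finsetSum _ fun k _ => hJi k]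
    simp [fun k => (hJ k).integral_eq_zero (hpre k)]
  have hcov : ∀ s ∈ Icc 0 t, ∀ v ∈ Icc 0 t, covMatrix P (Z s) (Z v)
      = covMatrix P (ξ 0) (ξ 0) + matrixIntegral (fun r => b r * (b r)ᵀ) 0 (min s v) := by
    intro s hs v hv
    ext i j
    obtain ⟨J, hJ, hJeq⟩ := hrep s hs i
    obtain ⟨K, hK, hKeq⟩ := hrep v hv j
    have hs' : (s.toNNReal : ℝ) = s := Real.coe_toNNReal s hs.1
    have hv' : (v.toNNReal : ℝ) = v := Real.coe_toNNReal v hv.1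
    have h := covariance_initial_add_noise hbm hb hV hξ0 hind (hs'.trans_le hs.2)
      (hv'.trans_le hv.2) hJ hK
    rw [hs', hv'] at h
    rw [Matrix.add_apply]
    refine Eq.trans ?_ h
    simp only [covMatrix, Matrix.of_apply, covariance, integral_congr_ae hJeq,
      integral_congr_ae hKeq]
    refine integral_congr_ae ?_
    filter_upwards [hJeq, hKeq] with ω h1 h2
    rw [h1, h2]
  have hZM : ∀ i, ∃ M, ∀ r ∈ Icc 0 t, ∫ ω, Z r ω i ^ 2 ∂P ≤ M := by
    intro i
    have hp := IsMatrixPrimitiveOn.of_matrixIntegral (F := fun s => covMatrix P (Z s) (Z s)) ht hβ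
      (covMatrix P (ξ 0) (ξ 0)) fun s hs => by rw [hcov s hs s hs, min_self]
    obtain ⟨M, hM⟩ := isCompact_Icc.exists_bound_of_continuousOn (hp i i).continuousOn
    refine ⟨M, fun r hr => le_trans (le_of_eq ?_) ((le_abs_self _).trans (hM r hr))⟩
    have h := covariance_eq_sub (hZL r hr i) (hZL r hr i)
    rw [hZmean r hr i, mul_zero, sub_zero] at h
    simp only [covMatrix, Matrix.of_apply]
    rw [h]
    simp only [Pi.mul_apply, sq]
  have hST : (covMatrix P (ξ 0) (ξ 0))ᵀ = covMatrix P (ξ 0) (ξ 0) := covMatrix_transpose _ _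
  have hβT : ∀ r, (b r * (b r)ᵀ)ᵀ = b r * (b r)ᵀ := fun r => by
    rw [Matrix.transpose_mul, Matrix.transpose_transpose]
  have hrepr : ∀ s ∈ Icc 0 t, ξ s =ᵐ[P] fun ω => Φ s *ᵥ partialIntegral A Ψ Z s ω := by
    intro s hs
    filter_upwards [hXξ] with ω hω
    rw [hZdef, partialIntegral_sub_integral ht hA hΨ hX hs ω, Matrix.mulVec_mulVec, hΦΨ s hs,
      Matrix.one_mulVec, hω]
  have hY := fun s (hs : s ∈ Icc 0 t) =>
    memLp_partialIntegral (P := P) ht hA hΨ.continuousOn hZ hZL hZM hs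
  refine ⟨fun s hs i => ?_, fun s hs v hv => ?_⟩
  · exact (memLp_congr_ae ((hrepr s hs).mono fun ω h => congrFun h i)).2
      (memLp_mulVec (Φ s) (hY s hs) i)
  · rw [covMatrix_congr (hrepr s hs) (hrepr v hv),
      covMatrix_mulVec_left _ (hY s hs) (memLp_mulVec _ (hY v hv)),
      covMatrix_mulVec_right _ (hY s hs) (hY v hv),
      covMatrix_partialIntegral_partialIntegral ht hA hΨ hΨ0 hZ hZL hZM hβ hβT hST hcov hs hv,
      Matrix.mul_assoc]

end SDE

/-! ### The covariance formula -/

theorem mainTheorem7 {Ω : Type*} [MeasurableSpace Ω] (P : Measure Ω) [IsProbabilityMeasure P]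
    {d₁ d₂ m₁ m₂ : ℕ}
    (a : ℝ → Matrix (Fin d₁) (Fin d₁) ℝ) (b : ℝ → Matrix (Fin d₁) (Fin m₁) ℝ)
    (c : ℝ → Matrix (Fin d₂) (Fin d₁) ℝ) (σ : ℝ → Matrix (Fin d₂) (Fin m₂) ℝ)
    (hcoef : LinearCoefficients a b c σ)
    (X₀ : Ω → Fin d₁ → ℝ) (hX₀ : HasGaussianLaw X₀ P)
    (V : Fin m₁ → ℝ≥0 → Ω → ℝ) (hV : IsBrownianVector P V)
    (u s t : ℝ) (hu : 0 ≤ u) (hus : u ≤ s) (hst : s ≤ t)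
    (φ : ℝ → Matrix (Fin d₁) (Fin d₁) ℝ) (hφ : IsBackwardRiccatiSolution a b c σ t φ)
    (γ : ℝ → Matrix (Fin d₁) (Fin d₁) ℝ)
    (hγ : IsForwardRiccatiSolution a b c σ (covMatrix P X₀ X₀) t γ)
    (hγ_nonsing : ∀ r ∈ Icc 0 t, IsUnit (γ r))
    (ξ : ℝ → Ω → Fin d₁ → ℝ)
    (hξ : IsSmoothingProcess P a b φ (covMatrix P X₀ X₀) V t ξ) :
    (∀ r ∈ Icc 0 t, ∀ i, MemLp (fun ω => ξ r ω i) 2 P) ∧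
    covMatrix P (ξ s) (ξ u) =
      covMatrix P (ξ s) (ξ s) *
        orderedExp (fun r => -((a r)ᵀ + (γ r)⁻¹ * b r * (b r)ᵀ)) u s := by
  have ht : 0 ≤ t := hu.trans (hus.trans hst)
  have h0 : (0 : ℝ) ∈ Icc 0 t := ⟨le_rfl, ht⟩
  have hut : u ∈ Icc 0 t := ⟨hu, hus.trans hst⟩
  have hs : s ∈ Icc 0 t := ⟨hu.trans hus, hst⟩
  have ha := hcoef.matrixIntegrableOn_a ht
  have hβ := hcoef.matrixIntegrableOn_mul_transpose_b ht
  set β : ℝ → Matrix (Fin d₁) (Fin d₁) ℝ := fun r => b r * (b r)ᵀ with hβdef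
  have hβT : ∀ r, (β r)ᵀ = β r := fun r => by
    rw [hβdef, Matrix.transpose_mul, Matrix.transpose_transpose]
  have hA : MatrixIntegrableOn (fun r => a r + β r * φ r) 0 t :=
    ha.add (hβ.mul_continuousOn ht hφ.continuousOn)
  obtain ⟨Φ, Ψ, hΦ, hΨ, hΨ0, hΦΨ⟩ := exists_fundamentalMatrix ht hA
  obtain ⟨hL, hcov⟩ := hξ.solution.memLp_and_covMatrix_eq ht hA hcoef.measurable_b
    (hcoef.integrable_b t ht) hV (fun i => (hξ.gaussian_init.eval i).memLp_two) hξ.mean_init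
    hξ.indep_init hΨ hΨ0 hΦΨ
  refine ⟨hL, ?_⟩
  set U : ℝ → Matrix (Fin d₁) (Fin d₁) ℝ := fun r => covMatrix P (ξ 0) (ξ 0)
    + matrixIntegral (fun r => Ψ r * β r * (Ψ r)ᵀ) 0 r
  have hU : IsMatrixPrimitiveOn U (fun r => Ψ r * β r * (Ψ r)ᵀ) 0 t :=
    .of_matrixIntegral ht ((hβ.continuousOn_mul ht hΨ.continuousOn).mul_continuousOn ht
      hΨ.transpose.continuousOn) _ fun _ _ => rfl
  -- By `V[ξ_r] = Φ(r) U(r) Φ(r)ᵀ`, the variance solves the Lyapunov equation.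
  have hVar : IsMatrixPrimitiveOn (fun r => covMatrix P (ξ r) (ξ r))
      (fun r => (a r + β r * φ r) * covMatrix P (ξ r) (ξ r)
        + covMatrix P (ξ r) (ξ r) * ((a r)ᵀ + φ r * β r) + β r) 0 t := by
    have hself : ∀ r ∈ Icc 0 t, covMatrix P (ξ r) (ξ r) = Φ r * U r * (Φ r)ᵀ := fun r hr => by
      rw [hcov r hr r hr, min_self]
    refine (isMatrixPrimitiveOn_lyapunov ht hΦ hU hΦΨ).congr hself fun r hr => ?_
    rw [hself r hr, Matrix.transpose_add, Matrix.transpose_mul, hφ.transpose_eq hr, hβT]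
  have hinit : covMatrix P (ξ 0) (ξ 0) * (1 - φ 0 * γ 0) = γ 0 := by
    rw [hξ.cov_init, hγ.init ht]
    exact sqrt_mul_inv_mul_sqrt_mul (hγ.init ht ▸ hγ.posSemidef 0 h0) (hφ.negSemidef 0 h0)
  -- Hence `V[ξ_r] = (γ(r)⁻¹ - φ(r))⁻¹`, written without inverses.
  have hVγ : ∀ r ∈ Icc 0 t, covMatrix P (ξ r) (ξ r) * (1 - φ r * γ r) = γ r := fun r hr =>
    lyapunov_mul_one_sub_eq ht ha hβ (hcoef.matrixIntegrableOn_quadratic_c ht)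
      (hφ.isMatrixPrimitiveOn hcoef ht) (hγ.isMatrixPrimitiveOn hcoef ht) hVar hinit hr
  -- From time `u` on, `r ↦ Cov(ξ_r, ξ_u)` solves the linear equation with drift `a + b bᵀ φ`.
  have hN : IsMatrixPrimitiveOn (fun r => covMatrix P (ξ r) (ξ u))
      (fun r => (a r + β r * φ r) * covMatrix P (ξ r) (ξ u)) u s := by
    have hform : ∀ r ∈ Icc u s, covMatrix P (ξ r) (ξ u) = Φ r * (U u * (Φ u)ᵀ) := fun r hr => by
      rw [hcov r ⟨hu.trans hr.1, hr.2.trans hst⟩ u hut, min_eq_right hr.1, Matrix.mul_assoc]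
    refine ((hΦ.mul ht (IsMatrixPrimitiveOn.const ht (U u * (Φ u)ᵀ))).mono hut hs hus).congr
      hform fun r hr => ?_
    rw [hform r hr, Matrix.mul_zero, add_zero]
    exact (Matrix.mul_assoc _ _ _).symm
  have hsub : Icc u s ⊆ Icc 0 t := Icc_subset_Icc hu hst
  have h := eq_lyapunov_mul_orderedExp hus (ha.mono hut hs) (hβ.mono hut hs)
    (hφ.continuousOn.mono hsub) (hγ.continuousOn.mono hsub) (fun r hr => hγ_nonsing r (hsub hr))
    (hVar.mono hut hs hus) (fun r hr => hVγ r (hsub hr)) hN rfl ⟨hus, le_rfl⟩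
  simpa only [hβdef, Matrix.mul_assoc] using h
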